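/- Let $\mathbb T$ be the unit circle with normalised arc length $m$, let $H^2$ be the Hardy space, regarded as the closed subspace of $L^2(\mathbb T)$ of functions with vanishing negative Fourier coefficients, let $P_+:L^2(\mathbb T)\to H^2$ be the orthogonal projection, and let $H^\infty$ be the space of bounded holomorphic functions on the unit disk, identified via boundary values with the functions in $L^\infty(\mathbb T)$ with vanishing negative Fourier coefficients, with norm $\|\cdot\|_\infty$. For $\psi\in L^\infty(\mathbb T)$ let $T_\psi f:=P_+(\psi f)$ $(f\in H^2)$. For $b\in H^\infty$ with $\|b\|_\infty\le 1$, the de Branges--Rovnyak space $\mathcal H(b)$ is the range of $(I-T_bT_{\overline b})^{1/2}:H^2\to H^2$, with the norm that makes this operator a partial isometry of $H^2$ onto $\mathcal H(b)$, that is, $\|(I-T_bT_{\overline b})^{1/2}g\|_{\mathcal H(b)}=\|g\|_{H^2}$ for $g\perp\ker (I-T_bT_{\overline b})^{1/2}$. Theorem. Suppose that $b$ is a non-extreme point of the closed unit ball of $H^\infty$. Then $\mathcal H(b)$ contains the polynomials, and the polynomials are dense in $\mathcal H(b)$. Moreover, approximating polynomials can be obtained as follows. There is an outer function $a\in H^\infty$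 with $a(0)>0$ and $|a|^2+|b|^2=1$ a.e. on $\mathbb T$, and, for every such $a$: (1) for every $\delta>0$ there is $h\in aH^\infty$ with $\|h\|_\infty\le1$ and $|1-h(0)|<\delta$; (2) for every $f\in\mathcal H(b)$ and every $\varepsilon>0$ there is $\delta>0$ such that, for every $h\in aH^\infty$ with $\|h\|_\infty\le 1$ and $|1-h(0)|<\delta$, there is $\eta>0$ such that there exist polynomials $p$ with $\|f-p\|_{H^2}<\eta$, and for every such polynomial $p$ the function $T_{\overline h}p$ is a polynomial that belongs to $\mathcal H(b)$ and satisfies $\|f-T_{\overline h}p\|_{\mathcal H(b)}<\varepsilon$. -/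

import Mathlib

open MeasureTheory Polynomial
open scoped ENNReal InnerProductSpace

noncomputable section

namespace DBR

/-! The unit circle is parametrised by `t ∈ ℝ / ℤ` through `t ↦ e^{2πit}`, which is `fourier 1 t`,
and carries the Haar probability measure. -/

/-- Normalised arc length on the unit circle. -/
abbrev circ : Measure UnitAddCircle := AddCircle.haarAddCircle

/-- The space `L²` of the circle. -/
abbrev LTwo : Type := Lp ℂ 2 circ

/-- The space `L^∞` of the circle. -/
abbrev LInf : Type := Lp ℂ ∞ circ

/-- The Hardy space `H²`: the elements of `L²` whose negative Fourier coefficients vanish. -/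
def hardyTwo : Submodule ℂ LTwo where
  carrier := {f | ∀ n : ℤ, n < 0 → fourierCoeff f n = 0}
  add_mem' := by
    intro f g hf hg n hn
    rw [← fourierBasis_repr, map_add, lp.coeFn_add, Pi.add_apply, fourierBasis_repr,
      fourierBasis_repr, hf n hn, hg n hn, add_zero]
  zero_mem' := by
    intro n _
    rw [← fourierBasis_repr, map_zero, lp.coeFn_zero, Pi.zero_apply]
  smul_mem' := by
    intro c f hf n hn
    rw [← fourierBasis_repr, map_smul, lp.coeFn_smul, Pi.smul_apply, fourierBasis_repr,
      hf n hn, smul_zero]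

theorem isClosed_hardyTwo : IsClosed (hardyTwo : Set LTwo) := by
  have h : (hardyTwo : Set LTwo) =
      ⋂ n : ℤ, ⋂ _ : n < 0, {f : LTwo | ⟪(fourierBasis n : LTwo), f⟫_ℂ = 0} := by
    ext f
    simp only [Set.mem_iInter, Set.mem_ofPred_eq, ← HilbertBasis.repr_apply_apply,
      fourierBasis_repr]
    rfl
  rw [h]
  exact isClosed_iInter fun n => isClosed_iInter fun _ =>
    isClosed_eq (by fun_prop) continuous_const

instance : CompleteSpace hardyTwo := isClosed_hardyTwo.completeSpace_coe

/-- The Hardy space `H²`, a Hilbert space with the norm of `L²`. -/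
abbrev HTwo : Type := hardyTwo

/-- The algebra `H^∞`, through boundary values: the elements of `L^∞` whose negative Fourier
coefficients vanish. -/
def HInf : Set LInf := {f | ∀ n : ℤ, n < 0 → fourierCoeff f n = 0}

/-- The closed unit ball of `H^∞`. -/
def ballHInf : Set LInf := {f | f ∈ HInf ∧ ‖f‖ ≤ 1}

/-- The value `f(z) = ∑_{n ≥ 0} f̂(n) zⁿ` (for `|z| < 1`) of the holomorphic function on the unit
disk whose boundary function is `f`. -/
def diskValue (f : UnitAddCircle → ℂ) (z : ℂ) : ℂ := ∑' n : ℕ, fourierCoeff f (n : ℤ) * z ^ n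

/-- Multiplication by `ψ ∈ L^∞` as an operator on `L²`. -/
def mulOp (ψ : LInf) : LTwo →L[ℂ] LTwo :=
  (ContinuousLinearMap.mul ℂ ℂ).holderL circ ∞ 2 2 ψ

theorem coeFn_mulOp (ψ : LInf) (f : LTwo) : mulOp ψ f =ᵐ[circ] fun t => ψ t * f t :=
  (ContinuousLinearMap.mul ℂ ℂ).coeFn_holder ψ f

/-- The Toeplitz operator `T_ψ f = P₊ (ψ f)` on `H²`. -/
def toeplitz (ψ : LInf) : HTwo →L[ℂ] HTwo :=
  hardyTwo.orthogonalProjectionOnto ∘L mulOp ψ ∘L hardyTwo.subtypeL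

/-- The positive square root of a positive operator on a Hilbert space. -/
def opSqrt {H : Type*} [NormedAddCommGroup H] [InnerProductSpace ℂ H] [CompleteSpace H]
    (T : H →L[ℂ] H) : H →L[ℂ] H :=
  CFC.sqrt T

theorem opSqrt_spec {H : Type*} [NormedAddCommGroup H] [InnerProductSpace ℂ H] [CompleteSpace H]
    {T : H →L[ℂ] H} (hT : T.IsPositive) :
    (opSqrt T).IsPositive ∧ opSqrt T * opSqrt T = T :=
  ⟨(ContinuousLinearMap.nonneg_iff_isPositive _).1 (CFC.sqrt_nonneg T),
    CFC.sqrt_mul_sqrt_self T ((ContinuousLinearMap.nonneg_iff_isPositive T).2 hT)⟩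

/-- The operator `(I - T_b T_{b̄})^{1/2}` on `H²`. -/
def defect (b : LInf) : HTwo →L[ℂ] HTwo :=
  opSqrt (1 - toeplitz b * toeplitz (star b))

/-- The de Branges–Rovnyak space `H(b)`: as a vector space, the range of
`(I - T_b T_{b̄})^{1/2}`. -/
def dBR (b : LInf) : Type := (defect b : HTwo →ₗ[ℂ] HTwo).range

instance (b : LInf) : AddCommGroup (dBR b) :=
  inferInstanceAs (AddCommGroup (defect b : HTwo →ₗ[ℂ] HTwo).range)

instance (b : LInf) : Module ℂ (dBR b) :=
  inferInstanceAs (Module ℂ (defect b : HTwo →ₗ[ℂ] HTwo).range)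

/-- The inclusion of `H(b)` in `H²`. -/
def dBR.incl {b : LInf} : dBR b →ₗ[ℂ] HTwo := (defect b : HTwo →ₗ[ℂ] HTwo).range.subtype

/-- The bijection from `H² ⊖ ker (I - T_b T_{b̄})^{1/2}` onto `H(b)` given by
`(I - T_b T_{b̄})^{1/2}`. -/
def dBR.equiv (b : LInf) : (defect b).kerᗮ ≃ₗ[ℂ] dBR b :=
  (defect b : HTwo →ₗ[ℂ] HTwo).kerComplementEquivRange
    (Submodule.isCompl_orthogonal (K := (defect b).ker)).symm

/-- The norm of `H(b)` makes that bijection isometric. -/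
instance (b : LInf) : NormedAddCommGroup (dBR b) :=
  NormedAddCommGroup.induced (dBR b) (defect b).kerᗮ (dBR.equiv b).symm
    (dBR.equiv b).symm.injective

instance (b : LInf) : NormedSpace ℂ (dBR b) :=
  NormedSpace.induced ℂ (dBR b) (defect b).kerᗮ (dBR.equiv b).symm

theorem dBR.incl_equiv (b : LInf) (g : (defect b).kerᗮ) :
    (dBR.equiv b g).incl = defect b (g : HTwo) := rfl

theorem dBR.norm_equiv (b : LInf) (g : (defect b).kerᗮ) :
    ‖dBR.equiv b g‖ = ‖(g : HTwo)‖ := by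
  change ‖(dBR.equiv b).symm (dBR.equiv b g)‖ = _
  rw [LinearEquiv.symm_apply_apply]
  rfl

/-- The function `zⁿ` as an element of `H²`. -/
def monomialHTwo (n : ℕ) : HTwo :=
  ⟨fourierLp 2 (n : ℤ), by
    intro m hm
    rw [← fourierBasis_repr, HilbertBasis.repr_apply_apply, coe_fourierBasis,
      orthonormal_fourier.2 (by omega)]⟩

/-- The polynomial `p` as an element of `H²`. -/
def polyHTwo (p : ℂ[X]) : HTwo := ∑ n ∈ p.support, p.coeff n • monomialHTwo n

/-- `a` is an outer function: `log |a|` is integrable on the circle and, for some `c` with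
`|c| = 1`, `a(z) = c exp (∫ (ζ + z) / (ζ - z) log |a(ζ)| dm(ζ))` on the unit disk. -/
def IsOuter (a : LInf) : Prop :=
  (∀ᵐ t ∂circ, a t ≠ 0) ∧ Integrable (fun t => Real.log ‖a t‖) circ ∧
    ∃ c : ℂ, ‖c‖ = 1 ∧ ∀ z : ℂ, ‖z‖ < 1 →
      diskValue a z = c * Complex.exp
        (∫ t, (fourier 1 t + z) / (fourier 1 t - z) * (Real.log ‖a t‖ : ℂ) ∂circ)

/-- `(b, a)` is a pair: `a ∈ H^∞` is outer, `a(0) > 0`, and `|a|² + |b|² = 1` a.e. on the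
circle. -/
def IsPair (b a : LInf) : Prop :=
  a ∈ HInf ∧ IsOuter a ∧ (∃ r : ℝ, 0 < r ∧ diskValue a 0 = (r : ℂ)) ∧
    ∀ᵐ t ∂circ, ‖a t‖ ^ 2 + ‖b t‖ ^ 2 = 1

/-- The set `a H^∞`. -/
def mulHInf (a : LInf) : Set LInf :=
  {h | ∃ k ∈ HInf, h =ᵐ[circ] fun t => a t * k t}

end DBR

end

namespace DBR

/-! Since `|a|² + |b|² = 1`, the operators `A = T_a` and `B = T_b` satisfy `A†A + B†B = 1`. A
Douglas-type duality argument then describes `H(b)`: `f` belongs to it exactly when `B†f = A†g` for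
some `g`, and such a pair bounds the norm by `‖f‖² + ‖g‖²` (`exists_eq_of_adjoint_eq`,
`exists_adjoint_eq_apply`). Approximation in `H(b)` thus becomes approximation of two vectors in
`H²`.

Co-analytic Toeplitz operators commute, so `T_h̄` sends a pair `(f, g)` to the pair `(T_h̄ f, T_h̄
g)`. If `h` lies in the unit ball of `H^∞` and `h(0)` is near `1`, then `T_h̄` is a contraction that
nearly fixes both vectors. If moreover `h = ak`, every `x ∈ H²` gives the pair `(T_h̄ x, T_b̄ T_k̄
x)`, so `T_h̄` maps `H²` boundedly into `H(b)`. Applied to `x = f - p` with `p` close to `f` in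
`H²`, this makes `T_h̄ p` close to `f` in `H(b)`, and `T_h̄ p` is a polynomial
(`exists_approximation`). Polynomials lie in `H(b)` because `T_ā zⁿ` does and has leading
coefficient `conj a(0) ≠ 0`.

It remains to produce `a` and `h`. Non-extremality gives a non-zero `g ∈ H^∞` with `|b|² + |g|² ≤ 1`
(`exists_norm_sq_add_le_one`); integrability of `log |g|²`, in the quantitative form
`exists_le_integral_log`, makes `log (1 - |b|²)` integrable, and `a` is the outer function of
modulus `(1 - |b|²)^{1/2}` (`exists_outer`). For `h`, multiply `a` by the outer function of modulus
`min (1/|a|, eⁿ)`. The outer formula for `a` enters only through `a(0) = exp ∫ log |a|`, which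
forces `h(0) → 1`. -/

theorem norm_sq_eq_re_inner_self {H : Type*} [NormedAddCommGroup H]
    [InnerProductSpace ℂ H] (x : H) : ‖x‖ ^ 2 = (⟪x, x⟫_ℂ).re :=
  norm_sq_eq_re_inner (𝕜 := ℂ) x

/-- Cauchy–Schwarz in `H ⊕ H`, with the sign absorbed into one component. -/
theorem norm_inner_sq_le_add {H : Type*} [NormedAddCommGroup H] [InnerProductSpace ℂ H]
    (f g x y : H) :
    ‖⟪f, x⟫_ℂ - ⟪g, y⟫_ℂ‖ ^ 2 ≤ (‖f‖ ^ 2 + ‖g‖ ^ 2) * (‖x‖ ^ 2 + ‖y‖ ^ 2) := by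
  have h1 : ‖⟪f, x⟫_ℂ - ⟪g, y⟫_ℂ‖ ≤ ‖f‖ * ‖x‖ + ‖g‖ * ‖y‖ :=
    (norm_sub_le _ _).trans (add_le_add (norm_inner_le_norm _ _) (norm_inner_le_norm _ _))
  calc ‖⟪f, x⟫_ℂ - ⟪g, y⟫_ℂ‖ ^ 2 ≤ (‖f‖ * ‖x‖ + ‖g‖ * ‖y‖) ^ 2 := by gcongr
    _ ≤ _ := by nlinarith [sq_nonneg (‖f‖ * ‖y‖ - ‖g‖ * ‖x‖)]

/-! ### Ranges of defect operators in an abstract Hilbert space -/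

section Hilbert

open ContinuousLinearMap

variable {H K : Type*} [NormedAddCommGroup H] [InnerProductSpace ℂ H] [CompleteSpace H]
  [NormedAddCommGroup K] [InnerProductSpace ℂ K] [CompleteSpace K]

/-- Douglas' lemma for a single vector. -/
theorem exists_adjoint_eq_of_norm_inner_le (S : H →L[ℂ] K) (f : H) {C : ℝ} (hC : 0 ≤ C)
    (h : ∀ v, ‖⟪f, v⟫_ℂ‖ ≤ C * ‖S v‖) : ∃ u : K, adjoint S u = f ∧ ‖u‖ ≤ C := by
  have hker : (S : H →ₗ[ℂ] K).ker ≤ ((innerSL ℂ f : H →L[ℂ] ℂ) : H →ₗ[ℂ] ℂ).ker := by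
    intro v hv
    have hv' : S v = 0 := hv
    have := h v
    rw [hv', norm_zero, mul_zero] at this
    exact norm_le_zero_iff.1 this
  -- The functional `S v ↦ ⟪f, v⟫` is well defined and bounded by `C` on the range of `S`; a
  -- Hahn–Banach extension of it, represented by Riesz, is the vector `u`.
  let L : (S : H →ₗ[ℂ] K).range →ₗ[ℂ] ℂ :=
    ((S : H →ₗ[ℂ] K).ker.liftQ _ hker) ∘ₗ ((S : H →ₗ[ℂ] K).quotKerEquivRange.symm : _ →ₗ[ℂ] _)
  have hL : ∀ v, L ⟨S v, v, rfl⟩ = ⟪f, v⟫_ℂ := by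
    intro v
    have : (S : H →ₗ[ℂ] K).quotKerEquivRange.symm ⟨S v, v, rfl⟩ = Submodule.Quotient.mk v := by
      rw [LinearEquiv.symm_apply_eq]
      rfl
    simp only [L, LinearMap.comp_apply, LinearEquiv.coe_coe]
    rw [this]
    rfl
  have hbound : ∀ y, ‖L y‖ ≤ C * ‖y‖ := by
    rintro ⟨_, v, rfl⟩
    exact (congrArg norm (hL v)).le.trans (h v)
  obtain ⟨g, hg, hgn⟩ := exists_extension_norm_eq _ (L.mkContinuous C hbound)
  refine ⟨(InnerProductSpace.toDual ℂ K).symm g, ext_inner_right ℂ fun v => ?_, ?_⟩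
  · rw [adjoint_inner_left, InnerProductSpace.toDual_symm_apply, ← hL v]
    exact hg ⟨S v, v, rfl⟩
  · rw [LinearIsometryEquiv.norm_map, hgn]
    exact L.mkContinuous_norm_le hC hbound

variable {A B D : H →L[ℂ] H}

/-- If `D² = 1 - B B†` with `D` self-adjoint, then `‖D v‖² = ‖v‖² - ‖B† v‖²`. -/
theorem norm_sq_of_sq_eq (hD : adjoint D = D) (hDD : D * D = 1 - B * adjoint B) (v : H) :
    ‖D v‖ ^ 2 = ‖v‖ ^ 2 - ‖adjoint B v‖ ^ 2 := by
  have h1 : D (D v) = v - B (adjoint B v) := by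
    simpa using congrArg (fun T : H →L[ℂ] H => T v) hDD
  have h2 : ⟪D v, D v⟫_ℂ = ⟪v, v⟫_ℂ - ⟪adjoint B v, adjoint B v⟫_ℂ := by
    rw [adjoint_inner_right, ← inner_sub_left, ← h1, ← adjoint_inner_left, hD]
  rw [norm_sq_eq_re_inner_self, norm_sq_eq_re_inner_self, norm_sq_eq_re_inner_self, h2,
    Complex.sub_re]

/-- With `w = B†v`, the relation `B†f = A†g` rewrites `⟪f, v⟫` as the pairing of `(f, -g)` with `(v
- Bw, -Aw)`. The squared norm of the latter is `‖v‖² - 2‖w‖² + ‖Bw‖² + ‖Aw‖² = ‖v‖² - ‖w‖² = ‖Dv‖²`,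
so Cauchy–Schwarz supplies the hypothesis of Douglas' lemma for `D`. -/
theorem exists_eq_of_adjoint_eq (hD : adjoint D = D) (hDD : D * D = 1 - B * adjoint B)
    (hAB : ∀ x, ‖A x‖ ^ 2 + ‖B x‖ ^ 2 = ‖x‖ ^ 2) {f g : H} (hfg : adjoint B f = adjoint A g) :
    ∃ u, D u = f ∧ ‖u‖ ^ 2 ≤ ‖f‖ ^ 2 + ‖g‖ ^ 2 := by
  have key : ∀ v, ‖⟪f, v⟫_ℂ‖ ≤ √(‖f‖ ^ 2 + ‖g‖ ^ 2) * ‖D v‖ := by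
    intro v
    set w := adjoint B v with hw
    have e1 : ⟪f, v⟫_ℂ = ⟪f, v - B w⟫_ℂ - ⟪g, -A w⟫_ℂ := by
      rw [inner_sub_right, inner_neg_right, ← adjoint_inner_left B w f,
        ← adjoint_inner_left A w g, hfg]
      ring
    have e2 : ‖v - B w‖ ^ 2 + ‖-A w‖ ^ 2 = ‖D v‖ ^ 2 := by
      rw [norm_neg, norm_sq_of_sq_eq hD hDD, norm_sub_sq (𝕜 := ℂ), ← hw,
        ← adjoint_inner_left B w v, ← hw, inner_self_eq_norm_sq (𝕜 := ℂ)]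
      linarith [hAB w]
    have h := norm_inner_sq_le_add f g (v - B w) (-A w)
    rw [← e1, e2] at h
    refine le_of_sq_le_sq ?_ (by positivity)
    rwa [mul_pow, Real.sq_sqrt (by positivity)]
  obtain ⟨u, hu, hun⟩ := exists_adjoint_eq_of_norm_inner_le D f (Real.sqrt_nonneg _) key
  refine ⟨u, by rwa [hD] at hu, ?_⟩
  calc ‖u‖ ^ 2 ≤ (√(‖f‖ ^ 2 + ‖g‖ ^ 2)) ^ 2 := by gcongr
    _ = _ := Real.sq_sqrt (by positivity)

/-- Converse of the preceding lemma, by Douglas' lemma for `A`: it suffices that `‖DBv‖ ≤ ‖Av‖`.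
This says `‖Bv‖² - ‖B†Bv‖² ≤ ‖v‖² - ‖Bv‖²`, which is `‖v - B†Bv‖² ≥ 0`. -/
theorem exists_adjoint_eq_apply (hD : adjoint D = D) (hDD : D * D = 1 - B * adjoint B)
    (hAB : ∀ x, ‖A x‖ ^ 2 + ‖B x‖ ^ 2 = ‖x‖ ^ 2) (u : H) :
    ∃ g, adjoint B (D u) = adjoint A g := by
  have key : ∀ v, ‖⟪adjoint B (D u), v⟫_ℂ‖ ≤ ‖u‖ * ‖A v‖ := by
    intro v
    have e : ⟪adjoint B (D u), v⟫_ℂ = ⟪u, D (B v)⟫_ℂ := by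
      rw [adjoint_inner_left, ← adjoint_inner_right, hD]
    rw [e]
    refine (norm_inner_le_norm _ _).trans ?_
    gcongr
    refine le_of_sq_le_sq ?_ (norm_nonneg _)
    have h1 : ‖v - adjoint B (B v)‖ ^ 2 = ‖v‖ ^ 2 - 2 * ‖B v‖ ^ 2 + ‖adjoint B (B v)‖ ^ 2 := by
      rw [norm_sub_sq (𝕜 := ℂ), adjoint_inner_right, inner_self_eq_norm_sq (𝕜 := ℂ)]
    rw [norm_sq_of_sq_eq hD hDD]
    nlinarith [hAB v, sq_nonneg ‖v - adjoint B (B v)‖]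
  obtain ⟨g, hg, -⟩ := exists_adjoint_eq_of_norm_inner_le A _ (norm_nonneg u) key
  exact ⟨g, hg.symm⟩

end Hilbert

/-! ### Fourier coefficients of products -/

section Fourier

theorem memLp_lInf (ψ : LInf) : MemLp ψ ∞ circ := Lp.memLp ψ

theorem memLp_two_lInf (ψ : LInf) : MemLp ψ 2 circ := (Lp.memLp ψ).mono_exponent le_top

theorem ae_norm_le_norm (ψ : LInf) : ∀ᵐ t ∂circ, ‖ψ t‖ ≤ ‖ψ‖ := by
  have h := ae_le_eLpNormEssSup (f := ψ) (μ := circ)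
  filter_upwards [h] with t ht
  rw [Lp.norm_def, eLpNorm_exponent_top, ← toReal_enorm]
  exact ENNReal.toReal_mono (by simpa using (Lp.memLp ψ).2.ne) ht

theorem norm_le_of_ae_le {ψ : LInf} {C : ℝ} (hC : 0 ≤ C) (h : ∀ᵐ t ∂circ, ‖ψ t‖ ≤ C) :
    ‖ψ‖ ≤ C := by
  simpa using Lp.norm_le_of_ae_bound hC h

theorem norm_fourier_apply (n : ℤ) (t : UnitAddCircle) : ‖fourier n t‖ = 1 := by
  rw [fourier_apply, Circle.norm_coe]

theorem fourierCoeff_eq_inner {f : UnitAddCircle → ℂ} (hf : MemLp f 2 circ) (n : ℤ) :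
    fourierCoeff f n = ⟪(fourierBasis n : LTwo), hf.toLp f⟫_ℂ := by
  rw [← HilbertBasis.repr_apply_apply, fourierBasis_repr, fourierCoeff_congr_ae hf.coeFn_toLp]

theorem norm_fourierCoeff_le (f : UnitAddCircle → ℂ) (n : ℤ) :
    ‖fourierCoeff f n‖ ≤ ∫ t, ‖f t‖ ∂circ := by
  refine (norm_integral_le_integral_norm _).trans (le_of_eq ?_)
  simp only [norm_smul, norm_fourier_apply, one_mul]

/-- The Fourier coefficients of a product of two `L²` functions. -/
theorem hasSum_fourierCoeff_mul {f g : UnitAddCircle → ℂ} (hf : MemLp f 2 circ)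
    (hg : MemLp g 2 circ) (n : ℤ) :
    HasSum (fun m : ℤ => fourierCoeff f (n - m) * fourierCoeff g m)
      (fourierCoeff (fun t => f t * g t) n) := by
  -- The inner product of `ζⁿ f̄` with `g` is the `n`-th coefficient of `fg`; Parseval's identity
  -- expands it as the convolution.
  have hfn : MemLp (fun t => fourier n t * star (f t)) 2 circ := by
    refine hf.star.of_le ?_ (Filter.Eventually.of_forall fun t => ?_)
    · exact (fourier n).continuous.aestronglyMeasurable.mul hf.star.1
    · rw [norm_mul, norm_fourier_apply, one_mul]
      rfl
  have h := fourierBasis.hasSum_inner_mul_inner (hfn.toLp _) (hg.toLp g)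
  have e0 : ⟪hfn.toLp _, hg.toLp g⟫_ℂ = fourierCoeff (fun t => f t * g t) n := by
    rw [L2.inner_def]
    refine integral_congr_ae ?_
    filter_upwards [hfn.coeFn_toLp, hg.coeFn_toLp] with t h1 h2
    rw [h1, h2, fourier_neg]
    simp [RCLike.inner_apply]
    ring
  rw [e0] at h
  refine h.congr_fun fun m => ?_
  rw [← fourierCoeff_eq_inner hg, ← inner_conj_symm, ← fourierCoeff_eq_inner hfn]
  congr 1
  simp only [fourierCoeff, ← integral_conj]
  refine integral_congr_ae (Filter.Eventually.of_forall fun t => ?_)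
  have : fourier (-(n - m)) t = fourier (-n) t * fourier m t := by
    rw [show -(n - m) = -n + m by omega, fourier_add]
  simp only [this, fourier_neg, smul_eq_mul, map_mul, Complex.conj_conj, RCLike.star_def]
  ring

/-- In the convolution, terms with `m < N` vanish through `g`, and the others through `f` because
then `n - m < 0`. At index `N` itself only `m = N` survives, which is the next lemma. -/
theorem fourierCoeff_mul_eq_zero {f g : UnitAddCircle → ℂ} (hf : MemLp f 2 circ)
    (hg : MemLp g 2 circ) (hf0 : ∀ n : ℤ, n < 0 → fourierCoeff f n = 0) {N : ℤ}
    (hgN : ∀ n : ℤ, n < N → fourierCoeff g n = 0) {n : ℤ} (hn : n < N) :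
    fourierCoeff (fun t => f t * g t) n = 0 := by
  refine (hasSum_fourierCoeff_mul hf hg n).unique ?_
  convert hasSum_zero with m
  rcases lt_or_ge m N with h | h
  · rw [hgN m h, mul_zero]
  · rw [hf0 _ (by omega), zero_mul]

theorem fourierCoeff_mul_eq {f g : UnitAddCircle → ℂ} (hf : MemLp f 2 circ)
    (hg : MemLp g 2 circ) (hf0 : ∀ n : ℤ, n < 0 → fourierCoeff f n = 0) {N : ℤ}
    (hgN : ∀ n : ℤ, n < N → fourierCoeff g n = 0) :
    fourierCoeff (fun t => f t * g t) N = fourierCoeff f 0 * fourierCoeff g N := by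
  refine (hasSum_fourierCoeff_mul hf hg N).unique ?_
  have h := hasSum_single (f := fun m : ℤ => fourierCoeff f (N - m) * fourierCoeff g m) N
    fun m hm => ?_
  · simpa using h
  · rcases lt_or_gt_of_ne hm with h | h
    · simp only [hgN m h, mul_zero]
    · rw [hf0 _ (by omega), zero_mul]

theorem ae_eq_zero_of_fourierCoeff_eq_zero {f : UnitAddCircle → ℂ} (hf : MemLp f 2 circ)
    (h : ∀ n, fourierCoeff f n = 0) : f =ᵐ[circ] 0 := by
  have : hf.toLp f = 0 := by
    refine fourierBasis.repr.map_eq_zero_iff.1 (lp.ext (funext fun n => ?_))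
    rw [HilbertBasis.repr_apply_apply, ← fourierCoeff_eq_inner hf, h]
    rfl
  exact hf.coeFn_toLp.symm.trans (this ▸ Lp.coeFn_zero ℂ 2 circ)

theorem diskValue_zero (f : UnitAddCircle → ℂ) : diskValue f 0 = fourierCoeff f 0 := by
  rw [diskValue, tsum_eq_single 0 fun n hn => by rw [zero_pow hn, mul_zero]]
  simp

end Fourier

/-! ### Toeplitz operators with analytic symbol and their adjoints -/

section Toeplitz

open ContinuousLinearMap

theorem norm_mulOp_le (ψ : LInf) (f : LTwo) : ‖mulOp ψ f‖ ≤ ‖ψ‖ * ‖f‖ := by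
  refine ((ContinuousLinearMap.mul ℂ ℂ).norm_holder_apply_apply_le ψ f).trans ?_
  rw [mul_assoc]
  exact mul_le_of_le_one_left (by positivity) (opNorm_mul_le ℂ ℂ)

theorem norm_toeplitz_apply_le (ψ : LInf) (f : HTwo) : ‖toeplitz ψ f‖ ≤ ‖ψ‖ * ‖f‖ :=
  (hardyTwo.norm_orthogonalProjectionOnto_apply_le _).trans (norm_mulOp_le ψ f)

theorem adjoint_toeplitz (ψ : LInf) : adjoint (toeplitz ψ) = toeplitz (star ψ) := by
  refine ContinuousLinearMap.ext fun f => ext_inner_right ℂ fun g => ?_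
  rw [adjoint_inner_left]
  simp only [toeplitz, coe_comp, Function.comp_apply, Submodule.subtypeL_apply]
  rw [Submodule.inner_orthogonalProjectionOnto_eq_of_mem_left,
    Submodule.inner_orthogonalProjectionOnto_eq_of_mem_right, L2.inner_def, L2.inner_def]
  refine integral_congr_ae ?_
  filter_upwards [coeFn_mulOp ψ g, coeFn_mulOp (star ψ) f, Lp.coeFn_star ψ] with t h1 h2 h3
  rw [h1, h2, h3]
  simp [RCLike.inner_apply]
  ring

/-- For an analytic symbol the product already lies in `H²`, so the projection does nothing. -/
theorem coeFn_toeplitz {a : LInf} (ha : a ∈ HInf) (f : HTwo) :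
    (toeplitz a f : LTwo) =ᵐ[circ] fun t => a t * (f : LTwo) t := by
  have hmem : mulOp a f ∈ hardyTwo := fun n hn => by
    rw [fourierCoeff_congr_ae (coeFn_mulOp a f)]
    exact fourierCoeff_mul_eq_zero (memLp_two_lInf a) (Lp.memLp _) ha f.2 hn
  have : (toeplitz a f : LTwo) = mulOp a f :=
    congrArg Subtype.val (Submodule.orthogonalProjectionOnto_mem_subspace_eq_self ⟨mulOp a f, hmem⟩)
  rw [this]
  exact coeFn_mulOp a f

theorem fourierCoeff_hTwo_eq_inner (f : HTwo) (n : ℕ) :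
    fourierCoeff (f : LTwo) n = ⟪monomialHTwo n, f⟫_ℂ := by
  rw [← fourierBasis_repr, HilbertBasis.repr_apply_apply, coe_fourierBasis]
  rfl

theorem hTwo_ext {f g : HTwo} (h : ∀ n : ℕ, ⟪monomialHTwo n, f⟫_ℂ = ⟪monomialHTwo n, g⟫_ℂ) :
    f = g := by
  refine Subtype.ext (fourierBasis.repr.injective (lp.ext (funext fun n => ?_)))
  rw [fourierBasis_repr, fourierBasis_repr]
  rcases lt_or_ge n 0 with hn | hn
  · rw [f.2 n hn, g.2 n hn]
  · lift n to ℕ using hn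
    rw [fourierCoeff_hTwo_eq_inner, fourierCoeff_hTwo_eq_inner, h]

theorem inner_smul_hTwo (f g : HTwo) (c : ℂ) : ⟪f, c • g⟫_ℂ = c * ⟪f, g⟫_ℂ :=
  inner_smul_right f g c

theorem inner_monomialHTwo (m n : ℕ) :
    ⟪monomialHTwo m, monomialHTwo n⟫_ℂ = if m = n then 1 else 0 := by
  have := (orthonormal_iff_ite.1 (orthonormal_fourier (T := 1))) m n
  simp only [Nat.cast_inj] at this
  exact this

theorem fourierCoeff_monomialHTwo_eq_zero {m : ℤ} {n : ℕ} (h : m < n) :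
    fourierCoeff (monomialHTwo n : LTwo) m = 0 := by
  rcases lt_or_ge m 0 with hm | hm
  · exact (monomialHTwo n).2 m hm
  · lift m to ℕ using hm
    rw [fourierCoeff_hTwo_eq_inner, inner_monomialHTwo, if_neg (by omega)]

theorem inner_monomialHTwo_toeplitz_of_lt {a : LInf} (ha : a ∈ HInf) {m n : ℕ} (h : m < n) :
    ⟪monomialHTwo m, toeplitz a (monomialHTwo n)⟫_ℂ = 0 := by
  rw [← fourierCoeff_hTwo_eq_inner, fourierCoeff_congr_ae (coeFn_toeplitz ha _)]
  exact fourierCoeff_mul_eq_zero (memLp_two_lInf a) (Lp.memLp _) ha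
    (fun k hk => fourierCoeff_monomialHTwo_eq_zero hk) (by exact_mod_cast h)

theorem inner_monomialHTwo_toeplitz_self {a : LInf} (ha : a ∈ HInf) (n : ℕ) :
    ⟪monomialHTwo n, toeplitz a (monomialHTwo n)⟫_ℂ = diskValue a 0 := by
  rw [← fourierCoeff_hTwo_eq_inner, fourierCoeff_congr_ae (coeFn_toeplitz ha _),
    fourierCoeff_mul_eq (memLp_two_lInf a) (Lp.memLp _) ha
    (fun k hk => fourierCoeff_monomialHTwo_eq_zero hk), fourierCoeff_hTwo_eq_inner,
    inner_monomialHTwo, if_pos rfl, mul_one, diskValue_zero]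

theorem toeplitz_apply_apply {a k h : LInf} (ha : a ∈ HInf) (hk : k ∈ HInf) (hh : h ∈ HInf)
    (e : h =ᵐ[circ] fun t => a t * k t) (f : HTwo) :
    toeplitz a (toeplitz k f) = toeplitz h f := by
  refine Subtype.ext (Lp.ext ?_)
  filter_upwards [coeFn_toeplitz ha (toeplitz k f), coeFn_toeplitz hk f, coeFn_toeplitz hh f, e]
    with t h1 h2 h3 h4
  rw [h1, h2, h3, h4, mul_assoc]

theorem toeplitz_comm {a k : LInf} (ha : a ∈ HInf) (hk : k ∈ HInf) (f : HTwo) :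
    toeplitz a (toeplitz k f) = toeplitz k (toeplitz a f) := by
  refine Subtype.ext (Lp.ext ?_)
  filter_upwards [coeFn_toeplitz ha (toeplitz k f), coeFn_toeplitz hk f,
    coeFn_toeplitz hk (toeplitz a f), coeFn_toeplitz ha f] with t h1 h2 h3 h4
  rw [h1, h2, h3, h4, mul_left_comm]

theorem norm_sq_lTwo (f : LTwo) : ‖f‖ ^ 2 = ∫ t, ‖f t‖ ^ 2 ∂circ := by
  rw [← (hasSum_sq_fourierCoeff f).tsum_eq, ← (fourierBasis.repr.norm_map f)]
  have := lp.norm_rpow_eq_tsum (p := 2) (by norm_num) (fourierBasis.repr f)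
  simp only [ENNReal.toReal_ofNat, Real.rpow_ofNat, fourierBasis_repr] at this
  exact this

theorem norm_sq_toeplitz_add {a b : LInf} (ha : a ∈ HInf) (hb : b ∈ HInf)
    (h : ∀ᵐ t ∂circ, ‖a t‖ ^ 2 + ‖b t‖ ^ 2 = 1) (f : HTwo) :
    ‖toeplitz a f‖ ^ 2 + ‖toeplitz b f‖ ^ 2 = ‖f‖ ^ 2 := by
  have hint : ∀ g : LTwo, Integrable (fun t => ‖g t‖ ^ 2) circ := fun g =>
    (Lp.memLp g).integrable_norm_pow (by norm_num)
  simp only [Submodule.coe_norm, norm_sq_lTwo]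
  rw [← integral_add (hint _) (hint _)]
  refine integral_congr_ae ?_
  filter_upwards [h, coeFn_toeplitz ha f, coeFn_toeplitz hb f] with t h1 h2 h3
  rw [h2, h3, norm_mul, norm_mul, mul_pow, mul_pow, ← add_mul, h1, one_mul]

theorem norm_adjoint_toeplitz_apply_le (h : LInf) (g : HTwo) :
    ‖adjoint (toeplitz h) g‖ ≤ ‖h‖ * ‖g‖ := by
  have : ‖adjoint (toeplitz h)‖ ≤ ‖h‖ := by
    rw [LinearIsometryEquiv.norm_map]
    exact (toeplitz h).opNorm_le_bound (norm_nonneg h) (norm_toeplitz_apply_le h)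
  exact (adjoint (toeplitz h)).le_of_opNorm_le this g

theorem adjoint_toeplitz_apply_le {h : LInf} (hn : ‖h‖ ≤ 1) (g : HTwo) :
    ‖adjoint (toeplitz h) g‖ ≤ ‖g‖ :=
  (norm_adjoint_toeplitz_apply_le h g).trans (mul_le_of_le_one_left (norm_nonneg _) hn)

theorem dense_span_monomialHTwo :
    Dense (Submodule.span ℂ (Set.range monomialHTwo) : Set HTwo) := by
  rw [Submodule.dense_iff_topologicalClosure_eq_top, Submodule.topologicalClosure_eq_top_iff,
    Submodule.eq_bot_iff]
  intro f hf
  refine hTwo_ext fun n => ?_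
  rw [inner_zero_right]
  exact hf _ (Submodule.subset_span ⟨n, rfl⟩)

/-- Expand the square: the cross term is `-2 Re h(0)`, since `T_h zⁿ` has `n`-th coefficient `h(0)`,
and the two squared norms are at most `1`. -/
theorem norm_monomialHTwo_sub_sq_le {h : LInf} (hh : h ∈ HInf) (hn : ‖h‖ ≤ 1) (n : ℕ) :
    ‖monomialHTwo n - adjoint (toeplitz h) (monomialHTwo n)‖ ^ 2 ≤ 2 * ‖1 - diskValue h 0‖ := by
  have h1 : ‖monomialHTwo n‖ ^ 2 = 1 := by
    rw [norm_sq_eq_re_inner_self, inner_monomialHTwo, if_pos rfl, Complex.one_re]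
  have h2 : ‖adjoint (toeplitz h) (monomialHTwo n)‖ ^ 2 ≤ 1 :=
    (pow_le_pow_left₀ (norm_nonneg _) (adjoint_toeplitz_apply_le hn _) 2).trans h1.le
  rw [norm_sub_sq (𝕜 := ℂ), adjoint_inner_right, ← inner_conj_symm,
    inner_monomialHTwo_toeplitz_self hh, h1]
  have h3 := Complex.re_le_norm (1 - diskValue h 0)
  simp only [Complex.sub_re, Complex.one_re] at h3
  simp only [RCLike.conj_re, RCLike.re_eq_complex_re]
  linarith

/-- `T_h̄ g → g` as `h(0) → 1` within the unit ball of `H^∞`. -/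
theorem exists_norm_sub_adjoint_toeplitz_lt (g : HTwo) {ε : ℝ} (hε : 0 < ε) :
    ∃ δ : ℝ, 0 < δ ∧ ∀ h ∈ HInf, ‖h‖ ≤ 1 → ‖1 - diskValue h 0‖ < δ →
      ‖g - adjoint (toeplitz h) g‖ < ε := by
  have key : ∀ x ∈ Submodule.span ℂ (Set.range monomialHTwo), ∀ ε : ℝ, 0 < ε →
      ∃ δ : ℝ, 0 < δ ∧ ∀ h ∈ HInf, ‖h‖ ≤ 1 → ‖1 - diskValue h 0‖ < δ →
        ‖x - adjoint (toeplitz h) x‖ < ε := by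
    intro x hx
    induction hx using Submodule.span_induction with
    | mem x hx =>
      obtain ⟨n, rfl⟩ := hx
      intro ε hε
      refine ⟨ε ^ 2 / 2, by positivity, fun h hh hn hd => ?_⟩
      refine lt_of_pow_lt_pow_left₀ 2 hε.le ((norm_monomialHTwo_sub_sq_le hh hn n).trans_lt ?_)
      linarith
    | zero => exact fun ε hε => ⟨1, one_pos, fun h _ _ _ => by simpa using hε⟩
    | add x y _ _ hx hy =>
      intro ε hε
      obtain ⟨δ₁, h1, H1⟩ := hx (ε / 2) (half_pos hε)
      obtain ⟨δ₂, h2, H2⟩ := hy (ε / 2) (half_pos hε)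
      refine ⟨min δ₁ δ₂, lt_min h1 h2, fun h hh hn hd => ?_⟩
      rw [map_add, add_sub_add_comm]
      refine (norm_add_le _ _).trans_lt ?_
      linarith [H1 h hh hn (hd.trans_le (min_le_left _ _)),
        H2 h hh hn (hd.trans_le (min_le_right _ _))]
    | smul c x _ hx =>
      intro ε hε
      obtain ⟨δ, h1, H1⟩ := hx (ε / (‖c‖ + 1)) (by positivity)
      refine ⟨δ, h1, fun h hh hn hd => ?_⟩
      have := H1 h hh hn hd
      rw [map_smul, ← smul_sub, norm_smul]
      rw [lt_div_iff₀ (by positivity)] at this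
      nlinarith [norm_nonneg (x - adjoint (toeplitz h) x)]
  -- The operators `T_h̄` are contractions uniformly in `h`, so convergence on the dense span of the
  -- monomials suffices.
  obtain ⟨x, hx, hgx⟩ := Metric.dense_iff.1 dense_span_monomialHTwo g (ε / 4) (by positivity)
  rw [Metric.mem_ball, dist_comm, dist_eq_norm] at hx
  obtain ⟨δ, h1, H1⟩ := key x hgx (ε / 4) (by positivity)
  refine ⟨δ, h1, fun h hh hn hd => ?_⟩
  have e : g - adjoint (toeplitz h) g
      = (g - x) + (x - adjoint (toeplitz h) x) - adjoint (toeplitz h) (g - x) := by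
    rw [map_sub]
    abel
  rw [e]
  refine (norm_sub_le _ _).trans_lt ?_
  linarith [norm_add_le (g - x) (x - adjoint (toeplitz h) x), H1 h hh hn hd,
    adjoint_toeplitz_apply_le hn (g - x)]

end Toeplitz

/-! ### Polynomials in `H²` -/

section Polynomials

theorem polyHTwo_add (p q : ℂ[X]) : polyHTwo (p + q) = polyHTwo p + polyHTwo q :=
  Polynomial.sum_add_index p q (fun n c => c • monomialHTwo n) (fun _ => zero_smul _ _)
    fun _ _ _ => add_smul _ _ _

theorem polyHTwo_C_mul_X_pow (n : ℕ) (c : ℂ) : polyHTwo (C c * X ^ n) = c • monomialHTwo n :=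
  by
  rw [C_mul_X_pow_eq_monomial]
  exact Polynomial.sum_monomial_index c (fun n c => c • monomialHTwo n) (zero_smul _ _)

theorem exists_polyHTwo_eq {x : HTwo} (hx : x ∈ Submodule.span ℂ (Set.range monomialHTwo)) :
    ∃ p : ℂ[X], polyHTwo p = x := by
  obtain ⟨c, rfl⟩ := (Finsupp.mem_span_range_iff_exists_finsupp).1 hx
  induction c using Finsupp.induction_linear with
  | zero => exact ⟨0, by simp [polyHTwo]⟩
  | add c d hc hd =>
    obtain ⟨p, hp⟩ := hc (Finsupp.mem_span_range_iff_exists_finsupp.2 ⟨c, rfl⟩)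
    obtain ⟨q, hq⟩ := hd (Finsupp.mem_span_range_iff_exists_finsupp.2 ⟨d, rfl⟩)
    refine ⟨p + q, ?_⟩
    rw [polyHTwo_add, hp, hq]
    exact (Finsupp.sum_add_index' (h := fun i a => a • monomialHTwo i) (fun _ => zero_smul _ _)
      fun _ _ _ => add_smul _ _ _).symm
  | single n a => exact ⟨C a * X ^ n, by rw [polyHTwo_C_mul_X_pow]; simp⟩

theorem exists_norm_sub_polyHTwo_lt (f : HTwo) {η : ℝ} (hη : 0 < η) :
    ∃ p : ℂ[X], ‖f - polyHTwo p‖ < η := by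
  obtain ⟨x, hx, hfx⟩ := Metric.dense_iff.1 dense_span_monomialHTwo f η hη
  obtain ⟨p, rfl⟩ := exists_polyHTwo_eq hfx
  exact ⟨p, by rwa [Metric.mem_ball, dist_comm, dist_eq_norm] at hx⟩

/-- An element of `H²` with finitely many non-zero coefficients is a combination of monomials. -/
theorem eq_sum_of_inner_eq_zero {f : HTwo} {N : ℕ}
    (h : ∀ n, N ≤ n → ⟪monomialHTwo n, f⟫_ℂ = 0) :
    f = ∑ n ∈ Finset.range N, ⟪monomialHTwo n, f⟫_ℂ • monomialHTwo n := by
  refine hTwo_ext fun n => ?_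
  simp only [inner_sum, inner_smul_hTwo, inner_monomialHTwo, mul_ite, mul_one, mul_zero,
    Finset.sum_ite_eq, Finset.mem_range]
  split_ifs with hn
  · rfl
  · exact h n (not_lt.1 hn)

/-- `T_h̄` maps polynomials to polynomials. -/
theorem exists_adjoint_toeplitz_polyHTwo {h : LInf} (hh : h ∈ HInf) (p : ℂ[X]) :
    ∃ q : ℂ[X], ContinuousLinearMap.adjoint (toeplitz h) (polyHTwo p) = polyHTwo q := by
  -- `T_h zⁿ` has no coefficients below index `n`, hence is orthogonal to `p` once `n` exceeds the
  -- degree.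
  have : ∀ n, p.natDegree + 1 ≤ n →
      ⟪monomialHTwo n, ContinuousLinearMap.adjoint (toeplitz h) (polyHTwo p)⟫_ℂ = 0 := by
    intro n hn
    rw [ContinuousLinearMap.adjoint_inner_right, polyHTwo, inner_sum]
    refine Finset.sum_eq_zero fun m hm => ?_
    rw [inner_smul_hTwo]
    have := Polynomial.le_natDegree_of_mem_supp m hm
    have h0 := inner_monomialHTwo_toeplitz_of_lt hh (show m < n by omega)
    rw [mul_eq_zero_of_right]
    exact (inner_eq_zero_symm (𝕜 := ℂ) (E := HTwo)).1 h0
  have e := eq_sum_of_inner_eq_zero this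
  obtain ⟨q, hq⟩ := exists_polyHTwo_eq (x := ContinuousLinearMap.adjoint (toeplitz h) (polyHTwo p))
    (by
      rw [e]
      exact Submodule.sum_mem _ fun n _ =>
        Submodule.smul_mem _ _ (Submodule.subset_span ⟨n, rfl⟩))
  exact ⟨q, hq.symm⟩

end Polynomials

/-! ### Polynomials in `H(b)` and approximation in its norm -/

section DeBrangesRovnyak

open ContinuousLinearMap

theorem defect_spec {b : LInf} (hb : ‖b‖ ≤ 1) :
    adjoint (defect b) = defect b ∧
      defect b * defect b = 1 - toeplitz b * adjoint (toeplitz b) := by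
  have hpos : (1 - toeplitz b * toeplitz (star b)).IsPositive := by
    rw [← adjoint_toeplitz]
    refine ContinuousLinearMap.isPositive_def'.2 ⟨?_, fun x => ?_⟩
    · exact (IsSelfAdjoint.one _).sub (IsSelfAdjoint.mul_star_self (toeplitz b))
    · have h : ‖adjoint (toeplitz b) x‖ ^ 2 ≤ ‖x‖ ^ 2 :=
        pow_le_pow_left₀ (norm_nonneg _) (adjoint_toeplitz_apply_le hb x) 2
      have e : ⟪(1 - toeplitz b * adjoint (toeplitz b)) x, x⟫_ℂ =
          ⟪x, x⟫_ℂ - ⟪adjoint (toeplitz b) x, adjoint (toeplitz b) x⟫_ℂ := by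
        rw [adjoint_inner_right]
        exact inner_sub_left (𝕜 := ℂ) (E := HTwo) _ _ _
      rw [reApplyInnerSelf_apply, RCLike.re_eq_complex_re, e, Complex.sub_re,
        ← norm_sq_eq_re_inner_self, ← norm_sq_eq_re_inner_self]
      linarith
  obtain ⟨h1, h2⟩ := opSqrt_spec hpos
  rw [adjoint_toeplitz]
  exact ⟨h1.isSelfAdjoint.adjoint_eq, h2⟩

/-- Projecting `u` onto the orthogonal complement of the kernel keeps its image and does not
increase its norm; hence any preimage bounds the norm in `H(b)`. -/
theorem exists_dBR_incl_eq_defect (b : LInf) (u : HTwo) :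
    ∃ F : dBR b, F.incl = defect b u ∧ ‖F‖ ≤ ‖u‖ := by
  refine ⟨dBR.equiv b ((defect b).kerᗮ.orthogonalProjectionOnto u), ?_, ?_⟩
  · rw [dBR.incl_equiv]
    have h := (defect b).kerᗮ.sub_starProjection_mem_orthogonal u
    rw [Submodule.orthogonal_orthogonal] at h
    have h' : defect b (u - (defect b).kerᗮ.starProjection u) = 0 := h
    rw [map_sub, sub_eq_zero] at h'
    exact h'.symm
  · rw [dBR.norm_equiv]
    exact (defect b).kerᗮ.norm_orthogonalProjectionOnto_apply_le u

theorem exists_incl_eq_of_adjoint_eq {a b : LInf} (ha : a ∈ HInf) (hb : b ∈ ballHInf)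
    (hab : ∀ᵐ t ∂circ, ‖a t‖ ^ 2 + ‖b t‖ ^ 2 = 1) {f g : HTwo}
    (h : adjoint (toeplitz b) f = adjoint (toeplitz a) g) :
    ∃ F : dBR b, F.incl = f ∧ ‖F‖ ^ 2 ≤ ‖f‖ ^ 2 + ‖g‖ ^ 2 := by
  obtain ⟨hD, hDD⟩ := defect_spec hb.2
  obtain ⟨u, hu, hun⟩ :=
    exists_eq_of_adjoint_eq hD hDD (norm_sq_toeplitz_add ha hb.1 hab) h
  obtain ⟨F, hF, hFn⟩ := exists_dBR_incl_eq_defect b u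
  exact ⟨F, hF.trans hu, (pow_le_pow_left₀ (norm_nonneg _) hFn 2).trans hun⟩

theorem exists_adjoint_incl_eq {a b : LInf} (ha : a ∈ HInf) (hb : b ∈ ballHInf)
    (hab : ∀ᵐ t ∂circ, ‖a t‖ ^ 2 + ‖b t‖ ^ 2 = 1) (f : dBR b) :
    ∃ g, adjoint (toeplitz b) f.incl = adjoint (toeplitz a) g := by
  obtain ⟨hD, hDD⟩ := defect_spec hb.2
  obtain ⟨u, hu⟩ : ∃ u, defect b u = f.incl := f.2
  rw [← hu]
  exact exists_adjoint_eq_apply hD hDD (norm_sq_toeplitz_add ha hb.1 hab) u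

theorem adjoint_toeplitz_comm {a k : LInf} (ha : a ∈ HInf) (hk : k ∈ HInf) (f : HTwo) :
    adjoint (toeplitz a) (adjoint (toeplitz k) f) =
      adjoint (toeplitz k) (adjoint (toeplitz a) f) := by
  refine ext_inner_right ℂ fun v => ?_
  rw [adjoint_inner_left, adjoint_inner_left, adjoint_inner_left, adjoint_inner_left,
    toeplitz_comm ha hk]

theorem adjoint_toeplitz_apply_apply {a k h : LInf} (ha : a ∈ HInf) (hk : k ∈ HInf) (hh : h ∈ HInf)
    (e : h =ᵐ[circ] fun t => a t * k t) (f : HTwo) :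
    adjoint (toeplitz h) f = adjoint (toeplitz a) (adjoint (toeplitz k) f) := by
  refine ext_inner_right ℂ fun v => ?_
  rw [adjoint_inner_left, adjoint_inner_left, adjoint_inner_left, toeplitz_comm hk ha,
    toeplitz_apply_apply ha hk hh e]

theorem mem_HInf_of_mul {a k h : LInf} (ha : a ∈ HInf) (hk : k ∈ HInf)
    (e : h =ᵐ[circ] fun t => a t * k t) : h ∈ HInf := fun n hn => by
  rw [fourierCoeff_congr_ae e]
  exact fourierCoeff_mul_eq_zero (memLp_two_lInf a) (memLp_two_lInf k) ha hk hn

/-- The range of `T_ā` is contained in `H(b)`. -/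
theorem exists_incl_eq_adjoint_toeplitz {a b : LInf} (ha : a ∈ HInf) (hb : b ∈ ballHInf)
    (hab : ∀ᵐ t ∂circ, ‖a t‖ ^ 2 + ‖b t‖ ^ 2 = 1) (x : HTwo) :
    ∃ F : dBR b, F.incl = adjoint (toeplitz a) x := by
  obtain ⟨F, hF, -⟩ := exists_incl_eq_of_adjoint_eq ha hb hab
    (adjoint_toeplitz_comm hb.1 ha x)
  exact ⟨F, hF⟩

/-- `T_ā zⁿ` lies in `H(b)` and is a polynomial of degree `n` with leading coefficient `conj a(0) ≠
0`, so `zⁿ` is obtained from it by subtracting lower monomials. -/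
theorem monomialHTwo_mem_range_incl {a b : LInf} (ha : a ∈ HInf) (hb : b ∈ ballHInf)
    (hab : ∀ᵐ t ∂circ, ‖a t‖ ^ 2 + ‖b t‖ ^ 2 = 1) (h0 : diskValue a 0 ≠ 0) (n : ℕ) :
    monomialHTwo n ∈ (dBR.incl (b := b)).range := by
  induction n using Nat.strong_induction_on with
  | _ n ih =>
    set x := adjoint (toeplitz a) (monomialHTwo n) with hx
    have hxr : x ∈ (dBR.incl (b := b)).range := exists_incl_eq_adjoint_toeplitz ha hb hab _
    have hsum := eq_sum_of_inner_eq_zero (f := x) (N := n + 1) fun m hm => by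
      rw [hx, adjoint_inner_right]
      exact (inner_eq_zero_symm (𝕜 := ℂ) (E := HTwo)).1
        (inner_monomialHTwo_toeplitz_of_lt ha (by omega))
    have hn : ⟪monomialHTwo n, x⟫_ℂ = star (diskValue a 0) := by
      rw [hx, adjoint_inner_right, ← inner_conj_symm, inner_monomialHTwo_toeplitz_self ha]
      rfl
    rw [Finset.sum_range_succ, hn] at hsum
    have h1 : star (diskValue a 0) • monomialHTwo n ∈ (dBR.incl (b := b)).range := by
      rw [← sub_eq_of_eq_add' hsum]
      exact Submodule.sub_mem _ hxr (Submodule.sum_mem _ fun m hm =>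
        Submodule.smul_mem _ _ (ih m (Finset.mem_range.1 hm)))
    exact (Submodule.smul_mem_iff _ (star_ne_zero.2 h0)).1 h1

theorem exists_incl_eq_polyHTwo {a b : LInf} (ha : a ∈ HInf) (hb : b ∈ ballHInf)
    (hab : ∀ᵐ t ∂circ, ‖a t‖ ^ 2 + ‖b t‖ ^ 2 = 1) (h0 : diskValue a 0 ≠ 0) (p : ℂ[X]) :
    ∃ f : dBR b, f.incl = polyHTwo p :=
  Submodule.sum_mem (dBR.incl (b := b)).range fun n _ =>
    Submodule.smul_mem _ _ (monomialHTwo_mem_range_incl ha hb hab h0 n)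

theorem exists_approximation {a b : LInf} (ha : a ∈ HInf) (hb : b ∈ ballHInf)
    (hab : ∀ᵐ t ∂circ, ‖a t‖ ^ 2 + ‖b t‖ ^ 2 = 1) (f : dBR b) {ε : ℝ} (hε : 0 < ε) :
    ∃ δ : ℝ, 0 < δ ∧ ∀ h ∈ mulHInf a, ‖h‖ ≤ 1 → ‖1 - diskValue h 0‖ < δ →
      ∃ η : ℝ, 0 < η ∧ (∃ p : ℂ[X], ‖f.incl - polyHTwo p‖ < η) ∧
        ∀ p : ℂ[X], ‖f.incl - polyHTwo p‖ < η →
          ∃ (q : ℂ[X]) (g : dBR b), toeplitz (star h) (polyHTwo p) = polyHTwo q ∧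
            g.incl = polyHTwo q ∧ ‖f - g‖ < ε := by
  obtain ⟨g, hg⟩ := exists_adjoint_incl_eq ha hb hab f
  obtain ⟨δ₁, hδ₁, H₁⟩ := exists_norm_sub_adjoint_toeplitz_lt f.incl (ε := ε / 4) (by positivity)
  obtain ⟨δ₂, hδ₂, H₂⟩ := exists_norm_sub_adjoint_toeplitz_lt g (ε := ε / 4) (by positivity)
  refine ⟨min δ₁ δ₂, lt_min hδ₁ hδ₂, ?_⟩
  rintro h ⟨k, hk, hhk⟩ hn hd
  have hh := mem_HInf_of_mul ha hk hhk
  replace H₁ := H₁ h hh hn (hd.trans_le (min_le_left _ _))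
  replace H₂ := H₂ h hh hn (hd.trans_le (min_le_right _ _))
  -- This `η` makes both `‖x‖` and `‖k‖ ‖x‖` less than `ε / 4` for `x = f - p`.
  have hη : 0 < ε / (4 * (1 + ‖k‖)) := by positivity
  refine ⟨_, hη, exists_norm_sub_polyHTwo_lt _ hη, fun p hp => ?_⟩
  obtain ⟨q, hq⟩ := exists_adjoint_toeplitz_polyHTwo hh p
  rw [lt_div_iff₀ (by positivity)] at hp
  obtain ⟨x, hx⟩ : ∃ x, x = f.incl - polyHTwo p := ⟨_, rfl⟩
  rw [← hx] at hp
  have hbn : ‖adjoint (toeplitz b) (adjoint (toeplitz k) x)‖ ≤ ‖k‖ * ‖x‖ :=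
    (adjoint_toeplitz_apply_le hb.2 _).trans (norm_adjoint_toeplitz_apply_le k x)
  have hxn := adjoint_toeplitz_apply_le hn x
  have hx0 := norm_nonneg x
  have hkx : 0 ≤ ‖k‖ * ‖x‖ := by positivity
  -- The error `f - T_h̄ p` splits as `(f - T_h̄ f) + T_h̄ x`. Its companion is `(g - T_h̄ g) + T_b̄
  -- T_k̄ x`, because `T_b̄ T_h̄ x = T_ā T_b̄ T_k̄ x`. Each has norm at most `ε / 2`.
  obtain ⟨F, hF, hFn⟩ := exists_incl_eq_of_adjoint_eq ha hb hab
    (f := (f.incl - adjoint (toeplitz h) f.incl) + adjoint (toeplitz h) x)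
    (g := (g - adjoint (toeplitz h) g) + adjoint (toeplitz b) (adjoint (toeplitz k) x)) (by
      rw [map_add, map_add, map_sub, map_sub, adjoint_toeplitz_comm hb.1 hh f.incl, hg,
        adjoint_toeplitz_comm ha hh, adjoint_toeplitz_comm ha hb.1,
        ← adjoint_toeplitz_apply_apply ha hk hh hhk])
  have hf1 := norm_add_le (f.incl - adjoint (toeplitz h) f.incl) (adjoint (toeplitz h) x)
  have hf2 := norm_add_le (g - adjoint (toeplitz h) g)
    (adjoint (toeplitz b) (adjoint (toeplitz k) x))
  refine ⟨q, f - F, by rw [← adjoint_toeplitz, hq], ?_, ?_⟩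
  · rw [map_sub, hF, hx, map_sub, hq]
    abel
  · rw [sub_sub_cancel]
    refine lt_of_pow_lt_pow_left₀ 2 hε.le (hFn.trans_lt ?_)
    have h1 := pow_le_pow_left₀ (norm_nonneg _) (hf1.trans (show _ ≤ ε / 2 by linarith)) 2
    have h2 := pow_le_pow_left₀ (norm_nonneg _) (hf2.trans (show _ ≤ ε / 2 by linarith)) 2
    nlinarith

end DeBrangesRovnyak

/-! ### Herglotz and Poisson kernels -/

section Herglotz

/-- The Herglotz–Riesz kernel `(ζ + z) / (ζ - z)` at `ζ = e^{2πit}`. -/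
noncomputable def kernel (z : ℂ) (t : UnitAddCircle) : ℂ := (fourier 1 t + z) / (fourier 1 t - z)

/-- The Poisson kernel `(1 - |z|²) / |ζ - z|²` at `ζ = e^{2πit}`. -/
noncomputable def poisson (z : ℂ) (t : UnitAddCircle) : ℝ :=
  (1 - ‖z‖ ^ 2) / ‖fourier 1 t - z‖ ^ 2

theorem fourier_sub_ne_zero {z : ℂ} (hz : ‖z‖ < 1) (t : UnitAddCircle) : fourier 1 t - z ≠ 0 := by
  rw [sub_ne_zero]
  rintro h
  rw [← h, norm_fourier_apply] at hz
  exact lt_irrefl _ hz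

theorem fourier_neg_natCast (n : ℕ) (t : UnitAddCircle) :
    fourier (-(n : ℤ)) t = (fourier 1 t)⁻¹ ^ n := by
  rw [fourier_apply, fourier_apply, AddCircle.toCircle_zsmul, one_zsmul]
  simp

theorem fourier_natCast (n : ℕ) (t : UnitAddCircle) :
    fourier (n : ℤ) t = fourier 1 t ^ n := by
  rw [fourier_apply, fourier_apply, AddCircle.toCircle_zsmul, one_zsmul]
  simp

theorem fourier_one_ne_zero (t : UnitAddCircle) : (fourier 1 t : ℂ) ≠ 0 := by
  rw [← norm_ne_zero_iff, norm_fourier_apply]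
  exact one_ne_zero

theorem continuous_kernel {z : ℂ} (hz : ‖z‖ < 1) : Continuous (kernel z) :=
  ((fourier 1).continuous.add continuous_const).div ((fourier 1).continuous.sub continuous_const)
    (fourier_sub_ne_zero hz)

theorem re_kernel (z : ℂ) (t : UnitAddCircle) :
    (kernel z t).re = poisson z t := by
  have h : Complex.normSq (fourier 1 t) = 1 := by
    rw [Complex.normSq_eq_norm_sq, norm_fourier_apply, one_pow]
  rw [kernel, poisson, Complex.div_re, ← Complex.normSq_eq_norm_sq, ← Complex.normSq_eq_norm_sq,
    ← add_div]
  congr 1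
  simp only [Complex.normSq_apply, Complex.add_re, Complex.add_im, Complex.sub_re,
    Complex.sub_im] at h ⊢
  linear_combination h

theorem continuous_poisson {z : ℂ} (hz : ‖z‖ < 1) : Continuous (poisson z) := by
  simp only [← funext (re_kernel z)]
  exact Complex.continuous_re.comp (continuous_kernel hz)

theorem poisson_nonneg {z : ℂ} (hz : ‖z‖ < 1) (t : UnitAddCircle) : 0 ≤ poisson z t := by
  refine div_nonneg ?_ (by positivity)
  nlinarith [norm_nonneg z]

theorem integrable_continuous_mul {φ : UnitAddCircle → ℂ} (hφ : Continuous φ)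
    {u : UnitAddCircle → ℂ} (hu : Integrable u circ) :
    Integrable (fun t => φ t * u t) circ := by
  obtain ⟨C, hC⟩ := (isCompact_range hφ).isBounded.exists_norm_le
  exact hu.bdd_mul hφ.aestronglyMeasurable
    (Filter.Eventually.of_forall fun t => hC _ ⟨t, rfl⟩)

theorem integrable_continuous_mul_real {φ : UnitAddCircle → ℝ} (hφ : Continuous φ)
    {u : UnitAddCircle → ℝ} (hu : Integrable u circ) :
    Integrable (fun t => φ t * u t) circ := by
  obtain ⟨C, hC⟩ := (isCompact_range hφ).isBounded.exists_norm_le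
  exact hu.bdd_mul hφ.aestronglyMeasurable
    (Filter.Eventually.of_forall fun t => hC _ ⟨t, rfl⟩)

theorem hasSum_diskValue {u : UnitAddCircle → ℂ} {z : ℂ} (hz : ‖z‖ < 1) :
    HasSum (fun n : ℕ => fourierCoeff u n * z ^ n) (diskValue u z) := by
  refine Summable.hasSum (Summable.of_norm_bounded (g := fun n => (∫ t, ‖u t‖ ∂circ) * ‖z‖ ^ n)
    ((summable_geometric_of_lt_one (norm_nonneg z) hz).mul_left _) fun n => ?_)
  rw [norm_mul, norm_pow]
  exact mul_le_mul_of_nonneg_right (norm_fourierCoeff_le u n) (by positivity)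

/-- The Herglotz integral as a power series. -/
theorem integral_kernel_mul {u : UnitAddCircle → ℂ} (hu : Integrable u circ) {z : ℂ}
    (hz : ‖z‖ < 1) : ∫ t, kernel z t * u t ∂circ = 2 * diskValue u z - fourierCoeff u 0 := by
  have hne : ∀ t, (1 - z * (fourier 1 t)⁻¹) ≠ 0 := fun t => by
    rw [← div_eq_mul_inv, one_sub_div (fourier_one_ne_zero t)]
    exact div_ne_zero (fourier_sub_ne_zero hz t) (fourier_one_ne_zero t)
  have hF : ∀ n : ℕ, Integrable (fun t => z ^ n * (fourier (-(n : ℤ)) t * u t)) circ := fun n =>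
    (integrable_continuous_mul (fourier (-(n : ℤ))).continuous hu).const_mul _
  have hsum := hasSum_integral_of_summable_integral_norm hF (by
    simp only [norm_mul, norm_pow, norm_fourier_apply, one_mul, integral_const_mul]
    exact (summable_geometric_of_lt_one (norm_nonneg z) hz).mul_right _)
  have hpt : ∀ t, ∑' n : ℕ, z ^ n * (fourier (-(n : ℤ)) t * u t)
      = (1 - z * (fourier 1 t)⁻¹)⁻¹ * u t := by
    intro t
    have h1 : ‖z * (fourier 1 t)⁻¹‖ < 1 := by
      rwa [norm_mul, norm_inv, norm_fourier_apply, inv_one, mul_one]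
    rw [← tsum_geometric_of_norm_lt_one h1, ← tsum_mul_right]
    refine tsum_congr fun n => ?_
    rw [fourier_neg_natCast, mul_pow, mul_assoc]
  simp only [hpt] at hsum
  have e1 : ∫ t, (1 - z * (fourier 1 t)⁻¹)⁻¹ * u t ∂circ = diskValue u z := by
    refine hsum.unique ((hasSum_diskValue hz).congr_fun fun n => ?_)
    rw [integral_const_mul, mul_comm]
    rfl
  have e2 : fourierCoeff u 0 = ∫ t, u t ∂circ := by simp [fourierCoeff]
  have hi : Integrable (fun t => (1 - z * (fourier 1 t)⁻¹)⁻¹ * u t) circ := by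
    refine integrable_continuous_mul ?_ hu
    exact (continuous_const.sub (continuous_const.mul
      ((fourier 1).continuous.inv₀ fourier_one_ne_zero))).inv₀ hne
  -- The kernel equals `2 / (1 - z ζ⁻¹) - 1`, and the first term is a geometric series in `z ζ⁻¹`.
  rw [← e1, e2, ← integral_const_mul, ← integral_sub (hi.const_mul 2) hu]
  refine integral_congr_ae (Filter.Eventually.of_forall fun t => ?_)
  have := fourier_sub_ne_zero hz t
  have h0 := fourier_one_ne_zero t
  have h1 := hne t
  simp only [kernel]
  field_simp
  ring

theorem fourierCoeff_fourier_eq (m n : ℤ) :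
    fourierCoeff (fourier m : UnitAddCircle → ℂ) n = if n = m then 1 else 0 := by
  rw [fourierCoeff_fourier, Pi.single_apply]

theorem integrable_fourier (n : ℤ) : Integrable (fourier n : UnitAddCircle → ℂ) circ :=
  (fourier n).continuous.integrable_of_hasCompactSupport
    (HasCompactSupport.of_compactSpace _)

theorem integral_poisson_mul {u : UnitAddCircle → ℝ} (hu : Integrable u circ) {z : ℂ}
    (hz : ‖z‖ < 1) : ∫ t, poisson z t * u t ∂circ = (∫ t, kernel z t * (u t : ℂ) ∂circ).re := by
  have := integral_re (integrable_continuous_mul (continuous_kernel hz)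
    (hu.ofReal : Integrable (fun t => (u t : ℂ)) circ))
  rw [RCLike.re_eq_complex_re] at this
  refine Eq.trans ?_ this
  refine integral_congr_ae (Filter.Eventually.of_forall fun t => ?_)
  simp only [RCLike.ofReal_eq_complex_ofReal]
  rw [Complex.re_mul_ofReal, re_kernel z]

theorem diskValue_fourier_natCast (n : ℕ) (z : ℂ) : diskValue (fourier (n : ℤ)) z = z ^ n := by
  rw [diskValue, tsum_eq_single n]
  · rw [fourierCoeff_fourier_eq, if_pos rfl, one_mul]
  · intro m hm
    rw [fourierCoeff_fourier_eq, if_neg (by exact_mod_cast hm), zero_mul]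

theorem diskValue_fourier_neg {n : ℤ} (hn : n < 0) (z : ℂ) : diskValue (fourier n) z = 0 := by
  rw [diskValue]
  convert tsum_zero with m
  rw [fourierCoeff_fourier_eq, if_neg (by omega), zero_mul]

/-- The Poisson integral of `ζⁿ` for `n ≥ 0`. -/
theorem integral_poisson_mul_fourier_natCast (n : ℕ) {z : ℂ} (hz : ‖z‖ < 1) :
    ∫ t, (poisson z t : ℂ) * fourier (n : ℤ) t ∂circ = z ^ n := by
  have h1 := integral_kernel_mul (integrable_fourier n) hz
  have h2 := congrArg (starRingEnd ℂ) (integral_kernel_mul (integrable_fourier (-n)) hz)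
  rw [← integral_conj] at h2
  -- The Poisson kernel is half the sum of the Herglotz kernel and its conjugate, so two Herglotz
  -- integrals, of `ζⁿ` and `ζ⁻ⁿ`, give the result.
  have e : ∀ t, (poisson z t : ℂ) * fourier (n : ℤ) t = (1 / 2 : ℂ) * (kernel z t * fourier n t
      + (starRingEnd ℂ) (kernel z t * fourier (-n : ℤ) t)) := by
    intro t
    rw [map_mul, fourier_neg, Complex.conj_conj, ← add_mul, Complex.add_conj, re_kernel z]
    push_cast
    ring
  have hi1 := integrable_continuous_mul (continuous_kernel hz) (integrable_fourier n)
  have hi2 := integrable_continuous_mul (continuous_kernel hz) (integrable_fourier (-n))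
  have hi3 : Integrable (fun t => (starRingEnd ℂ) (kernel z t * fourier (-n : ℤ) t)) circ :=
    (LinearIsometryEquiv.integrable_comp_iff Complex.conjLIE).2 hi2
  simp only [e]
  rw [integral_const_mul, integral_add hi1 hi3, h1, h2, diskValue_fourier_natCast,
    fourierCoeff_fourier_eq, fourierCoeff_fourier_eq]
  rcases Nat.eq_zero_or_pos n with rfl | hn
  · have := diskValue_fourier_natCast 0 z
    simp only [Nat.cast_zero] at this
    simp [this, map_ofNat]
    norm_num
  · rw [diskValue_fourier_neg (by omega), if_neg (by omega), if_neg (by omega)]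
    simp

theorem integral_poisson {z : ℂ} (hz : ‖z‖ < 1) : ∫ t, poisson z t ∂circ = 1 := by
  have := integral_poisson_mul_fourier_natCast 0 hz
  simp only [Nat.cast_zero, fourier_zero, mul_one, pow_zero] at this
  rw [integral_complex_ofReal] at this
  exact_mod_cast this

theorem norm_fourier_sub_comm (r : ℝ) (s t : UnitAddCircle) :
    ‖(fourier 1 s : ℂ) - r * fourier 1 t‖ = ‖(fourier 1 t : ℂ) - r * fourier 1 s‖ := by
  have hs : Complex.normSq (fourier 1 s) = 1 := by
    rw [Complex.normSq_eq_norm_sq, norm_fourier_apply, one_pow]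
  have ht : Complex.normSq (fourier 1 t) = 1 := by
    rw [Complex.normSq_eq_norm_sq, norm_fourier_apply, one_pow]
  rw [← sq_eq_sq₀ (norm_nonneg _) (norm_nonneg _), ← Complex.normSq_eq_norm_sq,
    ← Complex.normSq_eq_norm_sq]
  simp only [Complex.normSq_apply, Complex.sub_re, Complex.sub_im, Complex.re_ofReal_mul,
    Complex.im_ofReal_mul] at *
  linear_combination (1 - r ^ 2) * hs - (1 - r ^ 2) * ht

/-- This symmetry lets Fubini integrate the kernel in its other variable, for the `L¹` contraction
bound. -/
theorem poisson_comm (r : ℝ) (s t : UnitAddCircle) :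
    poisson (r * fourier 1 t) s = poisson (r * fourier 1 s) t := by
  rw [poisson, poisson, norm_fourier_sub_comm, norm_mul, norm_mul, norm_fourier_apply,
    norm_fourier_apply]

theorem norm_ofReal_mul_fourier {r : ℝ} (hr0 : 0 ≤ r) (t : UnitAddCircle) :
    ‖(r * fourier 1 t : ℂ)‖ = r := by
  rw [norm_mul, norm_fourier_apply, mul_one, Complex.norm_real, Real.norm_of_nonneg hr0]

end Herglotz

/-! ### Convergence of Poisson integrals in `L¹` -/

section PoissonIntegral

open Filter Topology

/-- The Poisson integral of a function on the circle. -/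
noncomputable def poissonInt (f : UnitAddCircle → ℂ) (z : ℂ) : ℂ :=
  ∫ t, (poisson z t : ℂ) * f t ∂circ

theorem poissonInt_congr_ae {f g : UnitAddCircle → ℂ} (h : f =ᵐ[circ] g) (z : ℂ) :
    poissonInt f z = poissonInt g z := by
  refine integral_congr_ae ?_
  filter_upwards [h] with t ht
  rw [ht]

theorem integrable_poisson_mul {f : UnitAddCircle → ℂ} (hf : Integrable f circ) {z : ℂ}
    (hz : ‖z‖ < 1) : Integrable (fun t => (poisson z t : ℂ) * f t) circ :=
  integrable_continuous_mul (Complex.continuous_ofReal.comp (continuous_poisson hz)) hf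

theorem poissonInt_add {f g : UnitAddCircle → ℂ} (hf : Integrable f circ)
    (hg : Integrable g circ) {z : ℂ} (hz : ‖z‖ < 1) :
    poissonInt (fun t => f t + g t) z = poissonInt f z + poissonInt g z := by
  simp only [poissonInt, mul_add]
  exact integral_add (integrable_poisson_mul hf hz) (integrable_poisson_mul hg hz)

theorem poissonInt_const_mul (c : ℂ) (f : UnitAddCircle → ℂ) (z : ℂ) :
    poissonInt (fun t => c * f t) z = c * poissonInt f z := by
  simp only [poissonInt, mul_left_comm _ c]
  exact integral_const_mul _ _

theorem poissonInt_conj (f : UnitAddCircle → ℂ) (z : ℂ) :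
    poissonInt (fun t => (starRingEnd ℂ) (f t)) z = (starRingEnd ℂ) (poissonInt f z) := by
  simp only [poissonInt, ← integral_conj, map_mul, Complex.conj_ofReal]

theorem continuous_poisson_prod {r : ℝ} (h0 : 0 ≤ r) (h1 : r < 1) :
    Continuous fun p : UnitAddCircle × UnitAddCircle => poisson (r * fourier 1 p.1) p.2 := by
  unfold poisson
  refine Continuous.div (by fun_prop) (by fun_prop) fun p => ?_
  have := fourier_sub_ne_zero ((norm_ofReal_mul_fourier h0 p.1).trans_lt h1) p.2
  positivity

theorem aestronglyMeasurable_poissonInt {f : UnitAddCircle → ℂ}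
    (hf : AEStronglyMeasurable f circ) {r : ℝ} (h0 : 0 ≤ r) (h1 : r < 1) :
    AEStronglyMeasurable (fun t => poissonInt f (r * fourier 1 t)) circ :=
  AEStronglyMeasurable.integral_prod_right'
    (f := fun p : UnitAddCircle × UnitAddCircle => (poisson (r * fourier 1 p.1) p.2 : ℂ) * f p.2)
    ((Complex.continuous_ofReal.comp (continuous_poisson_prod h0 h1)).aestronglyMeasurable.mul
      hf.comp_snd)

theorem lintegral_poisson {z : ℂ} (hz : ‖z‖ < 1) : ∫⁻ t, ENNReal.ofReal (poisson z t) ∂circ = 1 := by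
  rw [← ofReal_integral_eq_lintegral_ofReal, integral_poisson hz, ENNReal.ofReal_one]
  · exact (continuous_poisson hz).integrable_of_hasCompactSupport
      (HasCompactSupport.of_compactSpace _)
  · exact Eventually.of_forall (poisson_nonneg hz)

/-- The Poisson integral is a contraction of `L¹`. -/
theorem eLpNorm_poissonInt_le {f : UnitAddCircle → ℂ} (hf : AEStronglyMeasurable f circ) {r : ℝ}
    (h0 : 0 ≤ r) (h1 : r < 1) :
    eLpNorm (fun t => poissonInt f (r * fourier 1 t)) 1 circ ≤ eLpNorm f 1 circ := by
  have hz : ∀ t, ‖(r * fourier 1 t : ℂ)‖ < 1 := fun t => (norm_ofReal_mul_fourier h0 t).trans_lt h1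
  rw [eLpNorm_one_eq_lintegral_enorm, eLpNorm_one_eq_lintegral_enorm]
  calc ∫⁻ t, ‖poissonInt f (r * fourier 1 t)‖ₑ ∂circ
      ≤ ∫⁻ t, ∫⁻ s, ENNReal.ofReal (poisson (r * fourier 1 t) s) * ‖f s‖ₑ ∂circ ∂circ := by
        refine lintegral_mono fun t => (enorm_integral_le_lintegral_enorm _).trans_eq ?_
        refine lintegral_congr fun s => ?_
        rw [enorm_mul, ← ofReal_norm, Complex.norm_real,
          Real.norm_of_nonneg (poisson_nonneg (hz t) s)]
    _ = ∫⁻ s, ∫⁻ t, ENNReal.ofReal (poisson (r * fourier 1 t) s) * ‖f s‖ₑ ∂circ ∂circ :=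
        lintegral_lintegral_swap
          (((continuous_poisson_prod h0 h1).measurable.ennreal_ofReal.aemeasurable).mul
            hf.comp_snd.enorm)
    _ = ∫⁻ s, ‖f s‖ₑ ∂circ := by
        refine lintegral_congr fun s => ?_
        simp only [poisson_comm r s]
        rw [lintegral_mul_const _
          (continuous_poisson (hz s)).measurable.ennreal_ofReal, lintegral_poisson (hz s), one_mul]

/-- A sequence of radii increasing to `1`. -/
noncomputable def radius (k : ℕ) : ℝ := 1 - 1 / ((k : ℝ) + 1)

theorem radius_nonneg (k : ℕ) : 0 ≤ radius k := by
  rw [radius, sub_nonneg, div_le_one (by positivity)]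
  linarith [(Nat.cast_nonneg k : (0 : ℝ) ≤ k)]

theorem radius_lt_one (k : ℕ) : radius k < 1 := by
  rw [radius, sub_lt_self_iff]
  positivity

theorem tendsto_radius : Tendsto radius atTop (𝓝 1) := by
  have := (tendsto_one_div_add_atTop_nhds_zero_nat (𝕜 := ℝ)).const_sub 1
  rwa [sub_zero] at this

theorem norm_radius_mul_lt (k : ℕ) (t : UnitAddCircle) : ‖(radius k * fourier 1 t : ℂ)‖ < 1 :=
  (norm_ofReal_mul_fourier (radius_nonneg k) t).trans_lt (radius_lt_one k)

theorem poissonInt_fourier (n : ℤ) (r : ℝ) (h0 : 0 ≤ r) (h1 : r < 1) (t : UnitAddCircle) :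
    poissonInt (fourier n) (r * fourier 1 t) = (r : ℂ) ^ n.natAbs * fourier n t := by
  have hz := (norm_ofReal_mul_fourier h0 t).trans_lt h1
  obtain ⟨m, rfl | rfl⟩ := n.eq_nat_or_neg
  · rw [poissonInt, integral_poisson_mul_fourier_natCast m hz, mul_pow, fourier_natCast,
      Int.natAbs_natCast]
  · have := poissonInt_conj (fourier (m : ℤ)) (r * fourier 1 t)
    simp only [← fourier_neg] at this
    rw [this, poissonInt, integral_poisson_mul_fourier_natCast m hz, mul_pow, ← fourier_natCast,
      map_mul, ← fourier_neg, Int.natAbs_neg, Int.natAbs_natCast, map_pow, Complex.conj_ofReal]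

theorem tendsto_eLpNorm_poissonInt_fourier (n : ℤ) :
    Tendsto (fun k => eLpNorm (fun t => poissonInt (fourier n) (radius k * fourier 1 t)
      - fourier n t) 1 circ) atTop (𝓝 0) := by
  have e : ∀ k, eLpNorm (fun t => poissonInt (fourier n) (radius k * fourier 1 t)
      - fourier n t) 1 circ = ENNReal.ofReal ‖(radius k) ^ n.natAbs - 1‖ := by
    intro k
    rw [eLpNorm_one_eq_lintegral_enorm]
    have : ∀ t : UnitAddCircle, ‖poissonInt (fourier n) (radius k * fourier 1 t) - fourier n t‖ₑ =
        ENNReal.ofReal ‖(radius k) ^ n.natAbs - 1‖ := by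
      intro t
      rw [poissonInt_fourier n _ (radius_nonneg k) (radius_lt_one k), ← sub_one_mul,
        ← ofReal_norm, norm_mul, norm_fourier_apply, mul_one, ← Complex.norm_real]
      push_cast
      rfl
    simp only [this]
    simp
  simp only [e]
  rw [← ENNReal.ofReal_zero]
  refine ENNReal.tendsto_ofReal ?_
  have := ((tendsto_radius.pow n.natAbs).sub_const 1).norm
  simpa using this

theorem tendsto_eLpNorm_poissonInt_of_mem_span {g : Lp ℂ 1 circ}
    (hg : g ∈ Submodule.span ℂ (Set.range (fourierLp (T := 1) 1))) :
    Tendsto (fun k => eLpNorm (fun t => poissonInt g (radius k * fourier 1 t) - g t) 1 circ)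
      atTop (𝓝 0) := by
  have hint : ∀ g : Lp ℂ 1 circ, Integrable g circ := fun g => L1.integrable_coeFn g
  have hmeas : ∀ (g : Lp ℂ 1 circ) (k : ℕ), AEStronglyMeasurable
      (fun t => poissonInt g (radius k * fourier 1 t) - g t) circ := fun g k =>
    (aestronglyMeasurable_poissonInt (hint g).1 (radius_nonneg k) (radius_lt_one k)).sub (hint g).1
  induction hg using Submodule.span_induction with
  | mem g hg =>
    obtain ⟨n, rfl⟩ := hg
    refine (tendsto_eLpNorm_poissonInt_fourier n).congr fun k => eLpNorm_congr_ae ?_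
    filter_upwards [coeFn_fourierLp 1 n] with t ht
    rw [ht, poissonInt_congr_ae (coeFn_fourierLp 1 n)]
  | zero =>
    refine tendsto_const_nhds.congr fun k => ?_
    rw [eLpNorm_congr_ae (g := 0), eLpNorm_zero]
    filter_upwards [Lp.coeFn_zero ℂ 1 circ] with t ht
    rw [ht, poissonInt_congr_ae (Lp.coeFn_zero ℂ 1 circ)]
    simp [poissonInt]
  | add f g _ _ hf hg =>
    have := hf.add hg
    rw [add_zero] at this
    refine tendsto_of_tendsto_of_tendsto_of_le_of_le tendsto_const_nhds this
      (fun _ => zero_le) fun k => ?_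
    refine (eLpNorm_congr_ae ?_).trans_le (eLpNorm_add_le (hmeas f k) (hmeas g k) le_rfl)
    filter_upwards [Lp.coeFn_add f g] with t ht
    have e : (fun t => (f + g : Lp ℂ 1 circ) t) =ᵐ[circ] fun t => f t + g t := Lp.coeFn_add f g
    rw [ht, poissonInt_congr_ae e, poissonInt_add (hint f) (hint g) (norm_radius_mul_lt k t)]
    simp only [Pi.add_apply]
    ring
  | smul c f _ hf =>
    have := ENNReal.Tendsto.const_mul hf (Or.inr (enorm_ne_top (x := c)))
    rw [mul_zero] at this
    refine this.congr fun k => ?_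
    rw [← eLpNorm_const_smul]
    refine eLpNorm_congr_ae ?_
    filter_upwards [Lp.coeFn_smul c f] with t ht
    have e : (fun t => (c • f : Lp ℂ 1 circ) t) =ᵐ[circ] fun t => c * f t := Lp.coeFn_smul c f
    rw [ht, poissonInt_congr_ae e, poissonInt_const_mul]
    simp only [Pi.smul_apply, smul_eq_mul]
    ring

/-- Poisson integrals converge in `L¹` to the boundary function. -/
theorem tendsto_eLpNorm_poissonInt {f : UnitAddCircle → ℂ} (hf : Integrable f circ) :
    Tendsto (fun k => eLpNorm (fun t => poissonInt f (radius k * fourier 1 t) - f t) 1 circ)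
      atTop (𝓝 0) := by
  rw [ENNReal.tendsto_nhds_zero]
  intro ε hε
  have hε3 : 0 < ε / 3 := ENNReal.div_pos hε.ne' (by norm_num)
  have hf1 : MemLp f 1 circ := memLp_one_iff_integrable.2 hf
  obtain ⟨g, hg, hfg⟩ := EMetric.mem_closure_iff.1
    ((Submodule.dense_iff_topologicalClosure_eq_top.2
      (span_fourierLp_closure_eq_top (T := 1) ENNReal.one_ne_top)) (hf1.toLp f)) _ hε3
  have hgi := L1.integrable_coeFn g
  have hfgi : Integrable (fun t => f t - g t) circ := hf.sub hgi
  have hfg' : eLpNorm (fun t => f t - g t) 1 circ ≤ ε / 3 := by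
    rw [Lp.edist_def] at hfg
    refine (eLpNorm_congr_ae ?_).trans_le hfg.le
    filter_upwards [hf1.coeFn_toLp] with t ht
    simp [ht]
  filter_upwards [(ENNReal.tendsto_nhds_zero.1 (tendsto_eLpNorm_poissonInt_of_mem_span hg)) _ hε3]
    with k hk
  -- Contraction controls the first and last terms of the splitting, and the trigonometric
  -- polynomial `g` the middle one.
  have e : (fun t => poissonInt f (radius k * fourier 1 t) - f t) =
      ((fun t => poissonInt (fun t => f t - g t) (radius k * fourier 1 t)) +
        fun t => poissonInt g (radius k * fourier 1 t) - g t) - fun t => f t - g t := by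
    funext t
    have := poissonInt_add hfgi hgi (norm_radius_mul_lt k t)
    simp only [sub_add_cancel] at this
    simp only [Pi.add_apply, Pi.sub_apply]
    rw [this]
    ring
  have m1 := aestronglyMeasurable_poissonInt hfgi.1 (radius_nonneg k) (radius_lt_one k)
  have m2 := (aestronglyMeasurable_poissonInt hgi.1 (radius_nonneg k) (radius_lt_one k)).sub hgi.1
  rw [e]
  refine (eLpNorm_sub_le (m1.add m2) hfgi.1 le_rfl).trans ?_
  refine (add_le_add_left (eLpNorm_add_le m1 m2 le_rfl) _).trans ?_
  refine (add_le_add (add_le_add ((eLpNorm_poissonInt_le hfgi.1 (radius_nonneg k)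
    (radius_lt_one k)).trans hfg') hk) hfg').trans ?_
  rw [ENNReal.add_thirds]

end PoissonIntegral

/-! ### Boundary values of bounded power series -/

section BoundaryValues

open Filter Topology

theorem hasSum_mul_radius_fourier {G : ℂ → ℂ} {c : ℕ → ℂ}
    (hG : ∀ z, ‖z‖ < 1 → HasSum (fun n => c n * z ^ n) (G z)) {r : ℝ} (h0 : 0 ≤ r) (h1 : r < 1)
    (t : UnitAddCircle) :
    HasSum (fun n => c n * (r : ℂ) ^ n * fourier (n : ℤ) t) (G (r * fourier 1 t)) := by
  refine (hG _ ((norm_ofReal_mul_fourier h0 t).trans_lt h1)).congr_fun fun n => ?_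
  rw [fourier_natCast]
  ring

theorem summable_norm_mul_pow {G : ℂ → ℂ} {c : ℕ → ℂ}
    (hG : ∀ z, ‖z‖ < 1 → HasSum (fun n => c n * z ^ n) (G z)) {r : ℝ} (h0 : 0 ≤ r) (h1 : r < 1) :
    Summable fun n => ‖c n * (r : ℂ) ^ n‖ := by
  refine (hG r ?_).summable.norm
  rwa [Complex.norm_real, Real.norm_of_nonneg h0]

theorem continuous_comp_mul_fourier {G : ℂ → ℂ} {c : ℕ → ℂ}
    (hG : ∀ z, ‖z‖ < 1 → HasSum (fun n => c n * z ^ n) (G z)) {r : ℝ} (h0 : 0 ≤ r) (h1 : r < 1) :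
    Continuous fun t : UnitAddCircle => G (r * fourier 1 t) := by
  simp only [fun t => ((hasSum_mul_radius_fourier hG h0 h1 t).tsum_eq).symm]
  refine continuous_tsum (fun n => by fun_prop) (summable_norm_mul_pow hG h0 h1) fun n t => ?_
  rw [norm_mul, norm_fourier_apply, mul_one]

theorem fourierCoeff_comp_mul_fourier {G : ℂ → ℂ} {c : ℕ → ℂ}
    (hG : ∀ z, ‖z‖ < 1 → HasSum (fun n => c n * z ^ n) (G z)) {r : ℝ} (h0 : 0 ≤ r) (h1 : r < 1)
    (m : ℤ) : fourierCoeff (fun t : UnitAddCircle => G (r * fourier 1 t)) m =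
      if 0 ≤ m then c m.toNat * (r : ℂ) ^ m.toNat else 0 := by
  have hF : ∀ n : ℕ, Integrable (fun t : UnitAddCircle =>
      (c n * (r : ℂ) ^ n) * (fourier (-m) t * fourier (n : ℤ) t)) circ := fun n =>
    (integrable_continuous_mul (fourier (-m)).continuous (integrable_fourier n)).const_mul _
  have hsum := hasSum_integral_of_summable_integral_norm hF (by
    simp only [norm_mul _ (_ * _), norm_mul (fourier (-m) _), norm_fourier_apply, mul_one,
      integral_const, probReal_univ, one_smul]
    exact summable_norm_mul_pow hG h0 h1)
  have e : ∀ t : UnitAddCircle, ∑' n : ℕ,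
      (c n * (r : ℂ) ^ n) * (fourier (-m) t * fourier (n : ℤ) t) =
        fourier (-m) t • G (r * fourier 1 t) := by
    intro t
    rw [← (hasSum_mul_radius_fourier hG h0 h1 t).tsum_eq, smul_eq_mul, ← tsum_mul_left]
    exact tsum_congr fun n => by ring
  simp only [e] at hsum
  have e2 : ∀ n : ℕ, ∫ t : UnitAddCircle,
      (c n * (r : ℂ) ^ n) * (fourier (-m) t * fourier (n : ℤ) t) ∂circ =
        (c n * (r : ℂ) ^ n) * if m = n then 1 else 0 := by
    intro n
    rw [integral_const_mul, ← fourierCoeff_fourier_eq]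
    rfl
  simp only [e2] at hsum
  refine hsum.unique ?_
  split_ifs with hm
  · lift m to ℕ using hm
    have := hasSum_single (f := fun n : ℕ => (c n * (r : ℂ) ^ n) * if (m : ℤ) = n then 1 else 0) m
      fun n hn => by rw [if_neg (by exact_mod_cast hn.symm), mul_zero]
    simpa using this
  · convert hasSum_zero with n
    rw [if_neg (by omega), mul_zero]

theorem injective_natCast_int : Function.Injective (fun n : ℕ => (n : ℤ)) := Nat.cast_injective

theorem hasSum_int_of_nat {φ : ℕ → ℝ} {s : ℝ} (h : HasSum φ s) {ψ : ℤ → ℝ}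
    (h1 : ∀ n : ℕ, ψ n = φ n) (h2 : ∀ n : ℤ, n < 0 → ψ n = 0) : HasSum ψ s := by
  rw [← injective_natCast_int.hasSum_iff]
  · exact h.congr_fun h1
  · intro n hn
    refine h2 n (not_le.1 fun h => hn ⟨n.toNat, ?_⟩)
    simpa using h

/-- Bessel's inequality for a bounded holomorphic function. -/
theorem summable_sq_of_bounded {G : ℂ → ℂ} {c : ℕ → ℂ}
    (hG : ∀ z, ‖z‖ < 1 → HasSum (fun n => c n * z ^ n) (G z)) {B : ℝ}
    (hB : ∀ z, ‖z‖ < 1 → ‖G z‖ ≤ B) : Summable fun n => ‖c n‖ ^ 2 := by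
  have hB0 : 0 ≤ B := (norm_nonneg _).trans (hB 0 (by simp))
  refine summable_of_sum_range_le (c := B ^ 2) (fun n => by positivity) fun N => ?_
  -- Parseval on the circle of radius `r_k`; the finite sum then passes to the limit `r_k → 1`.
  have hk : ∀ k, ∑ n ∈ Finset.range N, ‖c n * (radius k : ℂ) ^ n‖ ^ 2 ≤ B ^ 2 := by
    intro k
    have hcont := continuous_comp_mul_fourier hG (radius_nonneg k) (radius_lt_one k)
    have hbd : ∀ t : UnitAddCircle, ‖G (radius k * fourier 1 t)‖ ≤ B := fun t =>
      hB _ (norm_radius_mul_lt k t)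
    have hL : MemLp (fun t : UnitAddCircle => G (radius k * fourier 1 t)) 2 circ :=
      MemLp.of_bound hcont.aestronglyMeasurable B (Eventually.of_forall hbd)
    have hs := hasSum_sq_fourierCoeff (hL.toLp _)
    rw [fourierCoeff_congr_ae hL.coeFn_toLp] at hs
    have h1 : ∫ t, ‖hL.toLp _ t‖ ^ 2 ∂circ ≤ B ^ 2 := by
      have : ∫ t : UnitAddCircle, B ^ 2 ∂circ = B ^ 2 := by simp
      rw [← this]
      refine integral_mono_ae ((Lp.memLp _).integrable_norm_pow (by norm_num))
        (integrable_const _) ?_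
      filter_upwards [hL.coeFn_toLp] with t ht
      rw [ht]
      exact pow_le_pow_left₀ (norm_nonneg _) (hbd t) 2
    refine le_trans ?_ h1
    refine le_trans (le_of_eq ?_) (sum_le_hasSum ((Finset.range N).map ⟨_, injective_natCast_int⟩)
      (fun _ _ => by positivity) hs)
    rw [Finset.sum_map]
    refine Finset.sum_congr rfl fun n _ => ?_
    rw [fourierCoeff_comp_mul_fourier hG (radius_nonneg k) (radius_lt_one k)]
    simp
  have hlim : Tendsto (fun k => ∑ n ∈ Finset.range N, ‖c n * (radius k : ℂ) ^ n‖ ^ 2) atTop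
      (𝓝 (∑ n ∈ Finset.range N, ‖c n * ((1 : ℝ) : ℂ) ^ n‖ ^ 2)) := by
    have hr : Tendsto (fun k => (radius k : ℂ)) atTop (𝓝 ((1 : ℝ) : ℂ)) :=
      (Complex.continuous_ofReal.tendsto 1).comp tendsto_radius
    exact tendsto_finsetSum _ fun n _ => (((hr.pow n).const_mul (c n)).norm.pow 2)
  have := le_of_tendsto' hlim hk
  simpa using this

/-- A bounded holomorphic function on the disk has boundary values in `L²`. -/
theorem exists_boundary_values {G : ℂ → ℂ} {c : ℕ → ℂ}
    (hG : ∀ z, ‖z‖ < 1 → HasSum (fun n => c n * z ^ n) (G z)) {B : ℝ}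
    (hB : ∀ z, ‖z‖ < 1 → ‖G z‖ ≤ B) :
    ∃ a : LTwo, (∀ n : ℤ, n < 0 → fourierCoeff a n = 0) ∧ (∀ n : ℕ, fourierCoeff a n = c n) ∧
      Tendsto (fun k => eLpNorm (fun t => G (radius k * fourier 1 t) - a t) 2 circ) atTop
        (𝓝 0) := by
  have hsq := summable_sq_of_bounded hG hB
  have hmem : Memℓp (fun m : ℤ => if 0 ≤ m then c m.toNat else 0) 2 := by
    rw [memℓp_gen_iff (by norm_num)]
    simp only [ENNReal.toReal_ofNat, Real.rpow_ofNat]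
    exact (hasSum_int_of_nat hsq.hasSum (fun n => by simp)
      (fun n hn => by simp [not_le.2 hn])).summable
  set a : LTwo := fourierBasis.repr.symm ⟨_, hmem⟩ with ha
  have hcoef : ∀ m : ℤ, fourierCoeff a m = if 0 ≤ m then c m.toNat else 0 := by
    intro m
    rw [← fourierBasis_repr, ha, LinearIsometryEquiv.apply_symm_apply]
  refine ⟨a, fun n hn => by rw [hcoef, if_neg (not_le.2 hn)], fun n => by rw [hcoef]; simp, ?_⟩
  have hL : ∀ k, MemLp (fun t : UnitAddCircle => G (radius k * fourier 1 t)) 2 circ := fun k =>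
    MemLp.of_bound (continuous_comp_mul_fourier hG (radius_nonneg k)
      (radius_lt_one k)).aestronglyMeasurable B
      (Eventually.of_forall fun t => hB _ (norm_radius_mul_lt k t))
  -- The dominating sequence for the `ℓ²` norm of the coefficients `c_n (r_kⁿ - 1)` of the
  -- difference.
  have hle : ∀ k n, ‖‖c n * ((radius k : ℂ) ^ n - 1)‖ ^ 2‖ ≤ ‖c n‖ ^ 2 := by
    intro k n
    have h1 : ‖(radius k : ℂ) ^ n - 1‖ ≤ 1 := by
      rw [← Complex.ofReal_pow, ← Complex.ofReal_one, ← Complex.ofReal_sub, Complex.norm_real,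
        Real.norm_eq_abs, abs_sub_comm, abs_of_nonneg]
      · linarith [pow_nonneg (radius_nonneg k) n]
      · linarith [pow_le_one₀ (n := n) (radius_nonneg k) (radius_lt_one k).le]
    rw [norm_pow, norm_norm, norm_mul]
    exact pow_le_pow_left₀ (by positivity) (mul_le_of_le_one_right (norm_nonneg _) h1) 2
  have hdiff : ∀ k (m : ℤ), fourierCoeff ((hL k).toLp _ - a : LTwo) m =
      if 0 ≤ m then c m.toNat * ((radius k : ℂ) ^ m.toNat - 1) else 0 := by
    intro k m
    rw [← fourierBasis_repr, map_sub, lp.coeFn_sub, Pi.sub_apply, fourierBasis_repr,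
      fourierBasis_repr, hcoef, fourierCoeff_congr_ae (hL k).coeFn_toLp,
      fourierCoeff_comp_mul_fourier hG (radius_nonneg k) (radius_lt_one k)]
    split_ifs <;> ring
  have hnorm : ∀ k, ‖(hL k).toLp _ - a‖ ^ 2 = ∑' n, ‖c n * ((radius k : ℂ) ^ n - 1)‖ ^ 2 := by
    intro k
    have h2 : Summable fun n => ‖c n * ((radius k : ℂ) ^ n - 1)‖ ^ 2 :=
      Summable.of_norm_bounded hsq (hle k)
    rw [norm_sq_lTwo, ← (hasSum_sq_fourierCoeff _).tsum_eq]
    refine (hasSum_int_of_nat h2.hasSum (fun n => ?_) fun n hn => ?_).tsum_eq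
    · rw [hdiff]
      simp
    · rw [hdiff, if_neg (not_le.2 hn)]
      simp
  have hlim : Tendsto (fun k => ∑' n, ‖c n * ((radius k : ℂ) ^ n - 1)‖ ^ 2) atTop (𝓝 0) := by
    have : Tendsto (fun k => ∑' n, ‖c n * ((radius k : ℂ) ^ n - 1)‖ ^ 2) atTop
        (𝓝 (∑' n, ‖c n * (((1 : ℝ) : ℂ) ^ n - 1)‖ ^ 2)) := by
      refine tendsto_tsum_of_dominated_convergence hsq (fun n => ?_)
        (Eventually.of_forall hle)
      have hr : Tendsto (fun k => (radius k : ℂ)) atTop (𝓝 ((1 : ℝ) : ℂ)) :=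
        (Complex.continuous_ofReal.tendsto 1).comp tendsto_radius
      exact ((((hr.pow n).sub_const 1).const_mul (c n)).norm.pow 2)
    simpa using this
  simp only [← hnorm] at hlim
  have hlim2 : Tendsto (fun k => ‖(hL k).toLp _ - a‖) atTop (𝓝 0) := by
    have := (Real.continuous_sqrt.tendsto 0).comp hlim
    simpa [Function.comp_def] using this
  have hlim3 := ENNReal.tendsto_ofReal hlim2
  rw [ENNReal.ofReal_zero] at hlim3
  refine hlim3.congr fun k => ?_
  rw [ofReal_norm, Lp.enorm_def]
  refine eLpNorm_congr_ae ?_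
  filter_upwards [Lp.coeFn_sub ((hL k).toLp _) a, (hL k).coeFn_toLp] with t h1 h2
  rw [h1, Pi.sub_apply, h2]

end BoundaryValues

/-! ### Construction of outer functions -/

section Outer

open Filter Topology

theorem differentiableOn_diskValue (u : UnitAddCircle → ℂ) :
    DifferentiableOn ℂ (diskValue u) (Metric.ball 0 1) := by
  intro z hz
  rw [mem_ball_zero_iff] at hz
  obtain ⟨r, hzr, hr⟩ := exists_between hz
  have hr0 : 0 ≤ r := (norm_nonneg z).trans hzr.le
  have : DifferentiableOn ℂ (fun z => ∑' n : ℕ, fourierCoeff u (n : ℤ) * z ^ n)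
      (Metric.ball 0 r) := by
    refine Complex.differentiableOn_tsum_of_summable_norm
      (u := fun n => (∫ t, ‖u t‖ ∂circ) * r ^ n)
      ((summable_geometric_of_lt_one hr0 hr).mul_left _) (fun n => by fun_prop)
      Metric.isOpen_ball fun n w hw => ?_
    rw [mem_ball_zero_iff] at hw
    rw [norm_mul, norm_pow]
    exact mul_le_mul (norm_fourierCoeff_le u n) (pow_le_pow_left₀ (norm_nonneg w) hw.le n)
      (by positivity) (integral_nonneg fun _ => norm_nonneg _)
  exact (this.differentiableAt (Metric.isOpen_ball.mem_nhds
    (by rwa [mem_ball_zero_iff]))).differentiableWithinAt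

/-- Existence of the outer function with prescribed modulus `e^u` on the circle. -/
theorem exists_outer {u : UnitAddCircle → ℝ} (hu : Integrable u circ) {M : ℝ}
    (hM : ∀ᵐ t ∂circ, u t ≤ M) :
    ∃ a ∈ HInf, (∀ᵐ t ∂circ, ‖a t‖ = Real.exp (u t)) ∧ ∀ z, ‖z‖ < 1 →
      diskValue a z = Complex.exp (∫ t, kernel z t * (u t : ℂ) ∂circ) := by
  have hu' : Integrable (fun t => (u t : ℂ)) circ := hu.ofReal
  set G : ℂ → ℂ := fun z => Complex.exp (∫ t, kernel z t * (u t : ℂ) ∂circ) with hGdef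
  have hnormG : ∀ z, ‖z‖ < 1 → ‖G z‖ = Real.exp (∫ t, poisson z t * u t ∂circ) := by
    intro z hz
    rw [hGdef, Complex.norm_exp, integral_poisson_mul hu hz]
  have hGB : ∀ z, ‖z‖ < 1 → ‖G z‖ ≤ Real.exp M := by
    intro z hz
    rw [hnormG z hz, Real.exp_le_exp]
    have hp : Integrable (poisson z) circ := (continuous_poisson hz).integrable_of_hasCompactSupport
      (HasCompactSupport.of_compactSpace _)
    calc ∫ t, poisson z t * u t ∂circ ≤ ∫ t, poisson z t * M ∂circ := by
          refine integral_mono_ae (integrable_continuous_mul_real (continuous_poisson hz) hu)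
            (hp.mul_const M) ?_
          filter_upwards [hM] with t ht
          exact mul_le_mul_of_nonneg_left ht (poisson_nonneg hz t)
      _ = M := by rw [integral_mul_const, integral_poisson hz, one_mul]
  -- The Herglotz integral is a power series in `z`, so `G` is holomorphic and has a Taylor series
  -- on the whole disk.
  have hGd : DifferentiableOn ℂ G (Metric.ball 0 1) := by
    have : DifferentiableOn ℂ (fun z => Complex.exp (2 * diskValue (fun t => (u t : ℂ)) z -
        fourierCoeff (fun t => (u t : ℂ)) 0)) (Metric.ball 0 1) :=
      (((differentiableOn_diskValue _).const_mul 2).sub_const _).cexp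
    refine this.congr fun z hz => ?_
    rw [mem_ball_zero_iff] at hz
    exact congrArg Complex.exp (integral_kernel_mul hu' hz)
  have hG : ∀ z, ‖z‖ < 1 → HasSum (fun n : ℕ =>
      ((n.factorial : ℂ)⁻¹ * iteratedDeriv n G 0) * z ^ n) (G z) := by
    intro z hz
    refine (Complex.hasSum_taylorSeries_on_ball hGd (mem_ball_zero_iff.2 hz)).congr_fun fun n => ?_
    simp only [sub_zero, smul_eq_mul]
    ring
  obtain ⟨a₂, hneg, hcoef, hlim⟩ := exists_boundary_values hG hGB
  have hmeas : ∀ k, AEStronglyMeasurable (fun t : UnitAddCircle => G (radius k * fourier 1 t))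
      circ := fun k =>
    (continuous_comp_mul_fourier hG (radius_nonneg k) (radius_lt_one k)).aestronglyMeasurable
  obtain ⟨ns, hns, hns'⟩ := (tendstoInMeasure_of_tendsto_eLpNorm two_ne_zero hmeas
    (Lp.memLp a₂).1 hlim).exists_seq_tendsto_ae
  -- A subsequence of the previous subsequence, so that `G` and the Poisson integral of `u` converge
  -- almost everywhere along the same radii. As `|G|` is the exponential of that integral, the
  -- limits give `|a| = e^u`.
  obtain ⟨ms, hms, hms'⟩ := (tendstoInMeasure_of_tendsto_eLpNorm one_ne_zero
    (fun k => aestronglyMeasurable_poissonInt hu'.1 (radius_nonneg (ns k)) (radius_lt_one (ns k)))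
    hu'.1 ((tendsto_eLpNorm_poissonInt hu').comp hns.tendsto_atTop)).exists_seq_tendsto_ae
  have hmod : ∀ᵐ t ∂circ, ‖a₂ t‖ = Real.exp (u t) := by
    filter_upwards [hns', hms'] with t h1 h2
    have h3 := (h1.comp hms.tendsto_atTop).norm
    have h4 := (Complex.continuous_re.tendsto _).comp h2
    have h5 := (Real.continuous_exp.tendsto _).comp h4
    refine tendsto_nhds_unique h3 (h5.congr fun k => ?_)
    simp only [Function.comp_apply]
    rw [hnormG _ (norm_radius_mul_lt _ t)]
    congr 1
    rw [poissonInt]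
    have : ∀ s, (poisson (radius (ns (ms k)) * fourier 1 t) s : ℂ) * (u s : ℂ) =
      ((poisson (radius (ns (ms k)) * fourier 1 t) s * u s : ℝ) : ℂ) := fun s => by push_cast; rfl
    simp only [this]
    rw [integral_complex_ofReal, Complex.ofReal_re]
  have hL : MemLp a₂ ∞ circ := memLp_top_of_bound (Lp.memLp a₂).1 (Real.exp M) (by
    filter_upwards [hmod, hM] with t h1 h2
    rw [h1]
    exact Real.exp_le_exp.2 h2)
  have hca := fourierCoeff_congr_ae hL.coeFn_toLp
  refine ⟨hL.toLp _, fun n hn => by rw [hca, hneg n hn], ?_, fun z hz => ?_⟩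
  · filter_upwards [hmod, hL.coeFn_toLp] with t h1 h2
    rw [h2, h1]
  · rw [diskValue, hca]
    simp only [hcoef]
    exact (hG z hz).tsum_eq

end Outer

/-! ### Integrability of logarithms -/

section LogIntegrability

open Filter Topology

theorem integral_kernel_zero_mul (u : UnitAddCircle → ℝ) :
    ∫ t, kernel 0 t * (u t : ℂ) ∂circ = ((∫ t, u t ∂circ : ℝ) : ℂ) := by
  rw [← integral_complex_ofReal]
  refine integral_congr_ae (Eventually.of_forall fun t => ?_)
  simp only [kernel, add_zero, sub_zero]
  rw [div_self (fourier_one_ne_zero t), one_mul]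

theorem integrable_log_add {w : UnitAddCircle → ℝ} (hw : Measurable w)
    (h0 : ∀ᵐ t ∂circ, 0 ≤ w t) {B : ℝ} (hB : ∀ᵐ t ∂circ, w t ≤ B) {ε : ℝ} (hε : 0 < ε) :
    Integrable (fun t => Real.log (w t + ε)) circ := by
  refine Integrable.of_bound (hw.add_const _).log.aestronglyMeasurable
    (|Real.log ε| + |Real.log (B + ε)|) ?_
  filter_upwards [h0, hB] with t ht htB
  have h1 : Real.log ε ≤ Real.log (w t + ε) := Real.log_le_log hε (by linarith)
  have h2 : Real.log (w t + ε) ≤ Real.log (B + ε) :=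
    Real.log_le_log (by linarith) (by linarith)
  rw [Real.norm_eq_abs, abs_le]
  constructor
  · linarith [neg_abs_le (Real.log ε), abs_nonneg (Real.log (B + ε))]
  · linarith [le_abs_self (Real.log (B + ε)), abs_nonneg (Real.log ε)]

theorem measurable_norm_sq_lInf (g : LInf) : Measurable fun t => ‖g t‖ ^ 2 :=
  (Lp.stronglyMeasurable g).measurable.norm.pow_const 2

theorem integrable_log_norm_sq_add (g : LInf) {ε : ℝ} (hε : 0 < ε) :
    Integrable (fun t => Real.log (‖g t‖ ^ 2 + ε)) circ := by
  refine integrable_log_add (measurable_norm_sq_lInf g)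
    (Eventually.of_forall fun _ => by positivity) (B := ‖g‖ ^ 2) ?_ hε
  filter_upwards [ae_norm_le_norm g] with t ht
  exact pow_le_pow_left₀ (norm_nonneg _) ht 2

/-- A quantitative form of the fact that a non-zero `H^∞` function has integrable logarithm. -/
theorem exists_le_integral_log {g : LInf} (hg : g ∈ HInf) (hg0 : g ≠ 0) :
    ∃ C : ℝ, ∀ ε : ℝ, 0 < ε → C ≤ ∫ t, Real.log (‖g t‖ ^ 2 + ε) ∂circ := by
  have hex : ∃ n : ℕ, fourierCoeff g n ≠ 0 := by
    by_contra! h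
    refine hg0 (Lp.ext ?_)
    refine (ae_eq_zero_of_fourierCoeff_eq_zero (memLp_two_lInf g) fun n => ?_).trans
      (Lp.coeFn_zero ℂ ∞ circ).symm
    rcases lt_or_ge n 0 with hn | hn
    · exact hg n hn
    · lift n to ℕ using hn
      exact h n
  classical
  set N := Nat.find hex with hN
  have hN0 : 0 < ‖fourierCoeff g N‖ := norm_pos_iff.2 (Nat.find_spec hex)
  have hlow : ∀ n : ℤ, n < N → fourierCoeff g n = 0 := by
    intro n hn
    rcases lt_or_ge n 0 with h | h
    · exact hg n h
    · lift n to ℕ using h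
      exact not_not.1 (Nat.find_min hex (by exact_mod_cast hn))
  refine ⟨2 * Real.log ‖fourierCoeff g N‖, fun ε hε => ?_⟩
  have hpos : ∀ t, 0 < ‖g t‖ ^ 2 + ε := fun t => by positivity
  have hint := integrable_log_norm_sq_add g hε
  -- `|O| = (|g|² + ε)^{-1/2}`, so `|Og| ≤ 1`. With `N` the order of vanishing of `g` at `0`, the
  -- `N`-th coefficient of `Og` is `O(0) ĝ(N)`; its modulus is at most `1`, and taking logarithms
  -- gives the bound.
  obtain ⟨O, hO, hOn, hOd⟩ := exists_outer (u := fun t => -(1 / 2) * Real.log (‖g t‖ ^ 2 + ε))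
    (M := -(1 / 2) * Real.log ε) (hint.const_mul _) (Eventually.of_forall fun t => by
      have h1 : Real.log ε ≤ Real.log (‖g t‖ ^ 2 + ε) :=
        Real.log_le_log hε (by linarith [sq_nonneg ‖g t‖])
      linarith)
  have hO0 : ‖fourierCoeff O 0‖ = Real.exp (-(1 / 2) * ∫ t, Real.log (‖g t‖ ^ 2 + ε) ∂circ) := by
    rw [← diskValue_zero, hOd 0 (by simp), integral_kernel_zero_mul, integral_const_mul,
      Complex.norm_exp, Complex.ofReal_re]
  have hle : ‖fourierCoeff (fun t => O t * g t) N‖ ≤ 1 := by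
    refine (norm_fourierCoeff_le _ _).trans ?_
    have h1 : ∫ _ : UnitAddCircle, (1 : ℝ) ∂circ = 1 := by simp
    refine le_of_le_of_eq ?_ h1
    refine integral_mono_of_nonneg (Eventually.of_forall fun _ => norm_nonneg _)
      (integrable_const _) ?_
    filter_upwards [hOn] with t ht
    rw [norm_mul, ht]
    refine le_of_sq_le_sq ?_ zero_le_one
    rw [mul_pow, ← Real.exp_nat_mul, one_pow]
    have : ((2 : ℕ) : ℝ) * (-(1 / 2) * Real.log (‖g t‖ ^ 2 + ε)) =
        -Real.log (‖g t‖ ^ 2 + ε) := by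
      push_cast
      ring
    rw [this, Real.exp_neg, Real.exp_log (hpos t), inv_mul_le_one₀ (hpos t)]
    linarith
  rw [fourierCoeff_mul_eq (memLp_two_lInf O) (memLp_two_lInf g) hO hlow, norm_mul, hO0,
    ← Real.exp_log hN0, ← Real.exp_add, Real.exp_le_one_iff] at hle
  linarith

/-- Fatou's lemma for `log 2 - log (w + 1/(n+1))`, non-negative since `w + 1/(n+1) ≤ 2`, with
integrals at most `log 2 - C`. The lower limit is infinite where `w = 0`, so that set is null;
elsewhere it is `log 2 - log w`. -/
theorem log_pos_and_integrable_of_le_integral_log {w : UnitAddCircle → ℝ} (hw : Measurable w)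
    (h0 : ∀ᵐ t ∂circ, 0 ≤ w t) (h1 : ∀ t, w t ≤ 1) {C : ℝ}
    (hC : ∀ ε : ℝ, 0 < ε → C ≤ ∫ t, Real.log (w t + ε) ∂circ) :
    (∀ᵐ t ∂circ, 0 < w t) ∧ Integrable (fun t => Real.log (w t)) circ := by
  set e : ℕ → ℝ := fun n => 1 / ((n : ℝ) + 1) with he
  have hepos : ∀ n, 0 < e n := fun n => by positivity
  have hele : ∀ n, e n ≤ 1 := fun n => by
    rw [he]
    simp only
    rw [div_le_one (by positivity)]
    linarith [(Nat.cast_nonneg n : (0 : ℝ) ≤ n)]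
  have helim : Tendsto e atTop (𝓝 0) := tendsto_one_div_add_atTop_nhds_zero_nat
  set F : ℕ → UnitAddCircle → ℝ≥0∞ := fun n t =>
    ENNReal.ofReal (Real.log 2 - Real.log (w t + e n)) with hF
  have hFmeas : ∀ n, Measurable (F n) := fun n =>
    (((hw.add_const _).log).const_sub _).ennreal_ofReal
  have hupper : ∀ n t, 0 < w t + e n → Real.log (w t + e n) ≤ Real.log 2 := fun n t h =>
    Real.log_le_log h (by linarith [h1 t, hele n])
  have hFint : ∀ n, ∫⁻ t, F n t ∂circ ≤ ENNReal.ofReal (Real.log 2 - C) := by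
    intro n
    have hi : Integrable (fun t => Real.log (w t + e n)) circ :=
      integrable_log_add hw h0 (Eventually.of_forall h1) (hepos n)
    have hi2 : Integrable (fun t => Real.log 2 - Real.log (w t + e n)) circ :=
      (integrable_const _).sub hi
    refine (ofReal_integral_eq_lintegral_ofReal hi2 ?_).symm.trans_le ?_
    · filter_upwards [h0] with t ht
      exact sub_nonneg.2 (hupper n t (by linarith [hepos n]))
    · refine ENNReal.ofReal_le_ofReal ?_
      rw [integral_sub (integrable_const _) hi]
      simp only [integral_const, probReal_univ, one_smul]
      linarith [hC (e n) (hepos n)]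
  have hlint : ∫⁻ t, liminf (fun n => F n t) atTop ∂circ ≤ ENNReal.ofReal (Real.log 2 - C) :=
    (lintegral_liminf_le hFmeas).trans
      (liminf_le_of_frequently_le' (Frequently.of_forall hFint))
  have hpos : ∀ᵐ t ∂circ, 0 < w t := by
    filter_upwards [h0, ae_lt_top (Measurable.liminf hFmeas)
      (hlint.trans_lt ENNReal.ofReal_lt_top).ne] with t ht hlt
    refine ht.lt_of_ne fun h => ?_
    have : Tendsto (fun n => F n t) atTop (𝓝 ⊤) := by
      simp only [hF, ← h, zero_add]
      refine ENNReal.tendsto_ofReal_atTop.comp ?_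
      have h2 : Tendsto (fun n => Real.log (e n)) atTop atBot :=
        Real.tendsto_log_nhdsGT_zero.comp
          (tendsto_nhdsWithin_iff.2 ⟨helim, Eventually.of_forall hepos⟩)
      exact tendsto_atTop_add_const_left _ _ (tendsto_neg_atBot_atTop.comp h2)
    rw [this.liminf_eq] at hlt
    exact lt_irrefl _ hlt
  refine ⟨hpos, ?_⟩
  have hint : Integrable (fun t => Real.log 2 - Real.log (w t)) circ := by
    refine ⟨(hw.log.const_sub _).aestronglyMeasurable, ?_⟩
    rw [hasFiniteIntegral_iff_ofReal]
    · refine lt_of_le_of_lt (le_of_eq_of_le (lintegral_congr_ae ?_) hlint) ENNReal.ofReal_lt_top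
      filter_upwards [hpos] with t ht
      refine (Tendsto.liminf_eq ?_).symm
      refine ENNReal.tendsto_ofReal (Tendsto.const_sub _ ?_)
      have := ((Real.continuousAt_log ht.ne').tendsto).comp
        (f := fun n => w t + e n) (x := atTop) (by simpa using helim.const_add (w t))
      exact this
    · filter_upwards [hpos] with t ht
      exact sub_nonneg.2 (Real.log_le_log ht (by linarith [h1 t]))
  exact ((integrable_const (Real.log 2)).sub hint).congr
    (Eventually.of_forall fun t => sub_sub_cancel _ _)

end LogIntegrability

/-! ### Non-extreme points, pairs, and multipliers in `aH^∞` -/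

section Pairs

open Filter Topology

theorem sub_mem_HInf {f g : LInf} (hf : f ∈ HInf) (hg : g ∈ HInf) : f - g ∈ HInf := by
  intro n hn
  have h : ∀ f : LInf, Integrable (fun t => fourier (-n) t • f t) circ := fun f =>
    integrable_continuous_mul (fourier (-n)).continuous ((memLp_lInf f).integrable le_top)
  rw [fourierCoeff_congr_ae (Lp.coeFn_sub f g)]
  simp only [fourierCoeff, Pi.sub_apply, smul_sub]
  rw [integral_sub (h f) (h g)]
  exact sub_eq_zero.2 ((hf n hn).trans (hg n hn).symm)

theorem smul_mem_HInf {f : LInf} (hf : f ∈ HInf) (c : ℂ) : c • f ∈ HInf := by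
  intro n hn
  rw [fourierCoeff_congr_ae (Lp.coeFn_smul c f)]
  exact (fourierCoeff.const_smul f c n).trans (by rw [hf n hn, smul_zero])

theorem norm_sq_convex_combination (x y : ℂ) {s t : ℝ} (hst : s + t = 1) :
    ‖(s : ℂ) * x + t * y‖ ^ 2 + s * t * ‖x - y‖ ^ 2 = s * ‖x‖ ^ 2 + t * ‖y‖ ^ 2 := by
  obtain rfl : t = 1 - s := by linarith
  simp only [← Complex.normSq_eq_norm_sq, Complex.normSq_apply, Complex.add_re, Complex.add_im,
    Complex.sub_re, Complex.sub_im, Complex.re_ofReal_mul, Complex.im_ofReal_mul]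
  ring

/-- If `b` is not extreme, then `|b|² + |g|² ≤ 1` for some non-zero `g ∈ H^∞`. -/
theorem exists_norm_sq_add_le_one {b : LInf} (hb : b ∈ ballHInf)
    (hne : b ∉ Set.extremePoints ℝ ballHInf) :
    ∃ g ∈ HInf, g ≠ 0 ∧ ∀ᵐ t ∂circ, ‖b t‖ ^ 2 + ‖g t‖ ^ 2 ≤ 1 := by
  simp only [mem_extremePoints_iff_left, not_and, not_forall] at hne
  obtain ⟨x, hx, y, hy, ⟨s, t, hs, ht, hst, rfl⟩, hxy⟩ := hne hb
  have hd : x ≠ y := by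
    rintro rfl
    exact hxy (by rw [← add_smul, hst, one_smul])
  have hst0 : 0 < s * t := mul_pos hs ht
  -- For `b = sx + ty`, the identity `|sx + ty|² + st |x - y|² = s|x|² + t|y|²` dictates this
  -- choice.
  refine ⟨((√(s * t) : ℝ) : ℂ) • (x - y), smul_mem_HInf (sub_mem_HInf hx.1 hy.1) _, ?_, ?_⟩
  · refine smul_ne_zero ?_ (sub_ne_zero.2 hd)
    exact_mod_cast (Real.sqrt_pos.2 hst0).ne'
  · filter_upwards [Lp.coeFn_add (s • x) (t • y), Lp.coeFn_smul s x, Lp.coeFn_smul t y,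
      Lp.coeFn_smul ((√(s * t) : ℝ) : ℂ) (x - y), Lp.coeFn_sub x y, ae_norm_le_norm x,
      ae_norm_le_norm y] with τ h1 h2 h3 h4 h5 h6 h7
    rw [h1, h4, Pi.add_apply, h2, h3, Pi.smul_apply, Pi.smul_apply, Pi.smul_apply, h5,
      Pi.sub_apply, norm_smul, mul_pow, Complex.norm_real, Real.norm_eq_abs, sq_abs,
      Real.sq_sqrt hst0.le, Complex.real_smul, Complex.real_smul,
      norm_sq_convex_combination _ _ hst]
    have h8 : ‖x τ‖ ^ 2 ≤ 1 := pow_le_one₀ (norm_nonneg _) (h6.trans hx.2)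
    have h9 : ‖y τ‖ ^ 2 ≤ 1 := pow_le_one₀ (norm_nonneg _) (h7.trans hy.2)
    nlinarith

theorem exists_isPair {b : LInf} (hb : b ∈ ballHInf)
    (hne : b ∉ Set.extremePoints ℝ ballHInf) : ∃ a, IsPair b a := by
  obtain ⟨g, hg, hg0, hbg⟩ := exists_norm_sq_add_le_one hb hne
  obtain ⟨C, hC⟩ := exists_le_integral_log hg hg0
  have hwmeas : Measurable fun t => 1 - ‖b t‖ ^ 2 :=
    (measurable_norm_sq_lInf b).const_sub 1
  have hw0 : ∀ᵐ t ∂circ, 0 ≤ 1 - ‖b t‖ ^ 2 := by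
    filter_upwards [hbg] with t ht
    linarith [sq_nonneg ‖g t‖]
  obtain ⟨hpos, hint⟩ := log_pos_and_integrable_of_le_integral_log hwmeas
    hw0 (fun t => by linarith [sq_nonneg ‖b t‖]) (C := C) fun ε hε => by
      refine (hC ε hε).trans (integral_mono_ae (integrable_log_norm_sq_add g hε)
        (integrable_log_add hwmeas hw0
          (Eventually.of_forall fun t => sub_le_self 1 (sq_nonneg ‖b t‖)) hε) ?_)
      filter_upwards [hbg] with t ht
      exact Real.log_le_log (by positivity) (by linarith)
  obtain ⟨a, ha, han, had⟩ := exists_outer (u := fun t => (1 / 2) * Real.log (1 - ‖b t‖ ^ 2))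
    (M := 0) (hint.const_mul _) (by
      filter_upwards [hpos] with t ht
      have := Real.log_nonpos ht.le (by linarith [sq_nonneg ‖b t‖])
      linarith)
  have hlog : (fun t => Real.log ‖a t‖) =ᵐ[circ] fun t => (1 / 2) * Real.log (1 - ‖b t‖ ^ 2) := by
    filter_upwards [han] with t ht
    rw [ht, Real.log_exp]
  refine ⟨a, ha, ⟨?_, (hint.const_mul _).congr hlog.symm, 1, norm_one, fun z hz => ?_⟩, ?_, ?_⟩
  · filter_upwards [han] with t ht
    rw [← norm_ne_zero_iff, ht]
    exact (Real.exp_pos _).ne'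
  · rw [had z hz, one_mul]
    congr 1
    refine integral_congr_ae ?_
    filter_upwards [hlog] with t ht
    rw [ht]
    rfl
  · refine ⟨Real.exp (∫ t, (1 / 2) * Real.log (1 - ‖b t‖ ^ 2) ∂circ), Real.exp_pos _, ?_⟩
    rw [had 0 (by simp), integral_kernel_zero_mul, Complex.ofReal_exp]
  · filter_upwards [han, hpos] with t ht hp
    rw [ht, ← Real.exp_nat_mul]
    have : ((2 : ℕ) : ℝ) * ((1 / 2) * Real.log (1 - ‖b t‖ ^ 2)) = Real.log (1 - ‖b t‖ ^ 2) := by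
      push_cast
      ring
    rw [this, Real.exp_log hp]
    ring

/-- The Herglotz kernel at `0` is `1`, and positivity of `a(0)` removes the unimodular constant. -/
theorem IsPair.diskValue_zero_eq {a b : LInf} (h : IsPair b a) :
    diskValue a 0 = Real.exp (∫ t, Real.log ‖a t‖ ∂circ) := by
  obtain ⟨-, ⟨-, -, c, hc, hd⟩, ⟨r, hr, hr0⟩, -⟩ := h
  have h1 : diskValue a 0 = c * Complex.exp (((∫ t, Real.log ‖a t‖ ∂circ : ℝ)) : ℂ) :=
    (hd 0 (by simp)).trans (by rw [← integral_kernel_zero_mul]; rfl)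
  have h2 := congrArg norm h1
  rw [norm_mul, hc, one_mul, Complex.norm_exp, Complex.ofReal_re, hr0, Complex.norm_real,
    Real.norm_of_nonneg hr.le] at h2
  rw [hr0, h2]

theorem IsPair.exists_mulHInf {a b : LInf} (h : IsPair b a) {δ : ℝ} (hδ : 0 < δ) :
    ∃ h ∈ mulHInf a, ‖h‖ ≤ 1 ∧ ‖1 - diskValue h 0‖ < δ := by
  have ha0 := h.diskValue_zero_eq
  obtain ⟨ha, ⟨hne, hint, -⟩, -, hab⟩ := h
  have hl0 : ∀ᵐ t ∂circ, Real.log ‖a t‖ ≤ 0 := by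
    filter_upwards [hab] with t ht
    refine Real.log_nonpos (norm_nonneg _) (le_of_sq_le_sq ?_ zero_le_one)
    nlinarith [sq_nonneg ‖b t‖]
  -- Truncation keeps the outer function `k` with `|k| = exp v_n` bounded, while `|ak| ≤ 1` and
  -- `(ak)(0) = exp (∫ log |a| + ∫ v_n) → 1`.
  set v : ℕ → UnitAddCircle → ℝ := fun n t => min (-Real.log ‖a t‖) n with hv
  have hvint : ∀ n, Integrable (v n) circ := fun n => hint.neg.inf (integrable_const _)
  have hlim : Tendsto (fun n => ∫ t, v n t ∂circ) atTop (𝓝 (∫ t, -Real.log ‖a t‖ ∂circ)) := by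
    refine tendsto_integral_of_dominated_convergence (fun t => ‖Real.log ‖a t‖‖)
      (fun n => (hvint n).1) hint.norm (fun n => ?_) (Eventually.of_forall fun t => ?_)
    · filter_upwards [hl0] with t ht
      rw [Real.norm_of_nonpos ht, Real.norm_of_nonneg]
      · exact min_le_left _ _
      · exact le_min (by linarith) (Nat.cast_nonneg n)
    · obtain ⟨n₀, hn₀⟩ := exists_nat_ge (-Real.log ‖a t‖)
      refine tendsto_const_nhds.congr' ?_
      filter_upwards [eventually_ge_atTop n₀] with n hn
      exact (min_eq_left (hn₀.trans (by exact_mod_cast hn))).symm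
  have hlim2 : Tendsto (fun n => ‖(1 : ℂ) -
      (Real.exp (∫ t, Real.log ‖a t‖ ∂circ + ∫ t, v n t ∂circ) : ℝ)‖) atTop (𝓝 0) := by
    have h1 := ((Complex.continuous_ofReal.comp Real.continuous_exp).tendsto _).comp
      (hlim.const_add (∫ t, Real.log ‖a t‖ ∂circ))
    have h2 := (h1.const_sub 1).norm
    simpa [integral_neg, Function.comp_def] using h2
  obtain ⟨n, hn⟩ := (hlim2.eventually_lt_const hδ).exists
  obtain ⟨k, hk, hkn, hkd⟩ := exists_outer (hvint n) (M := n)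
    (Eventually.of_forall fun t => min_le_right _ _)
  have hbd : ∀ᵐ t ∂circ, ‖a t * k t‖ ≤ 1 := by
    filter_upwards [hkn, hne] with t h1 h2
    rw [norm_mul, h1, ← Real.exp_log (norm_pos_iff.2 h2), ← Real.exp_add, Real.exp_le_one_iff]
    linarith [min_le_left (-Real.log ‖a t‖) (n : ℝ)]
  have hL : MemLp (fun t => a t * k t) ∞ circ :=
    memLp_top_of_bound ((Lp.memLp a).1.mul (Lp.memLp k).1) 1 hbd
  refine ⟨hL.toLp _, ⟨k, hk, hL.coeFn_toLp⟩, norm_le_of_ae_le zero_le_one ?_, ?_⟩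
  · filter_upwards [hL.coeFn_toLp, hbd] with t h1 h2
    rwa [h1]
  · rw [diskValue_zero, fourierCoeff_congr_ae hL.coeFn_toLp,
      fourierCoeff_mul_eq (memLp_two_lInf a) (memLp_two_lInf k) ha hk, ← diskValue_zero,
      ← diskValue_zero, ha0, hkd 0 (by simp), integral_kernel_zero_mul, ← Complex.ofReal_exp,
      ← Complex.ofReal_mul, ← Real.exp_add]
    exact hn

end Pairs

end DBR

theorem theoremT (b : DBR.LInf) (hb : b ∈ DBR.ballHInf)
    (hne : b ∉ Set.extremePoints ℝ DBR.ballHInf) :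
    -- polynomials belong to `H(b)` and are dense in it
    (∀ p : Polynomial ℂ, ∃ f : DBR.dBR b, f.incl = DBR.polyHTwo p) ∧
    Dense {f : DBR.dBR b | ∃ p : Polynomial ℂ, f.incl = DBR.polyHTwo p} ∧
    -- the construction of approximating polynomials
    (∃ a : DBR.LInf, DBR.IsPair b a) ∧
    ∀ a : DBR.LInf, DBR.IsPair b a →
      (∀ δ : ℝ, 0 < δ → ∃ h ∈ DBR.mulHInf a, ‖h‖ ≤ 1 ∧ ‖1 - DBR.diskValue h 0‖ < δ) ∧
      ∀ (f : DBR.dBR b) (ε : ℝ), 0 < ε →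
        ∃ δ : ℝ, 0 < δ ∧ ∀ h ∈ DBR.mulHInf a, ‖h‖ ≤ 1 → ‖1 - DBR.diskValue h 0‖ < δ →
          ∃ η : ℝ, 0 < η ∧ (∃ p : Polynomial ℂ, ‖f.incl - DBR.polyHTwo p‖ < η) ∧
            ∀ p : Polynomial ℂ, ‖f.incl - DBR.polyHTwo p‖ < η →
              ∃ (q : Polynomial ℂ) (g : DBR.dBR b),
                DBR.toeplitz (star h) (DBR.polyHTwo p) = DBR.polyHTwo q ∧
                g.incl = DBR.polyHTwo q ∧ ‖f - g‖ < ε := by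
  obtain ⟨a, hab⟩ := DBR.exists_isPair hb hne
  have hpoly : ∀ p : Polynomial ℂ, ∃ f : DBR.dBR b, f.incl = DBR.polyHTwo p := by
    refine DBR.exists_incl_eq_polyHTwo hab.1 hb hab.2.2.2 ?_
    obtain ⟨r, hr, hr0⟩ := hab.2.2.1
    rw [hr0]
    exact_mod_cast hr.ne'
  refine ⟨hpoly, fun f => Metric.mem_closure_iff.2 fun ε hε => ?_, ⟨a, hab⟩,
    fun a hab => ⟨fun δ hδ => hab.exists_mulHInf hδ, fun f ε hε => DBR.exists_approximation hab.1 hb hab.2.2.2 f hε⟩⟩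
  -- Density follows from the construction, carried out for one pair, one `h` and one `p`.
  obtain ⟨δ, hδ, H⟩ := DBR.exists_approximation hab.1 hb hab.2.2.2 f hε
  obtain ⟨h, hh, hn, hd⟩ := hab.exists_mulHInf hδ
  obtain ⟨η, -, ⟨p, hp⟩, K⟩ := H h hh hn hd
  obtain ⟨q, g, -, hg, hfg⟩ := K p hp
  exact ⟨g, ⟨q, hg⟩, by rwa [dist_eq_norm]⟩
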